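/- Let $\Gamma$ be a finitely generated, recursively presented group: for a finite generating set $S$, the set of words $w\in S^*$ whose product $\underline w$ is $1_\Gamma$ is recursively enumerable. Suppose that $\Gamma$ is self-simulable: for every effectively closed set $Z\subset\{0,1\}^{\mathbb N}$ (the complement of a union of cylinders over a recursively enumerable set of words) and every computable action $\Gamma\curvearrowright Z$ (each element $s$ of some finite generating set acts by a computable map, that is, the preimage of the cylinder of a word $w$ is the trace on $Z$ of a set that is effectively open uniformly in $w$), the action $\Gamma\curvearrowright Z$ is a topological factor of a $\Gamma$-subshift of finite type. Here a $\Gamma$-subshift of finite type is a set of the form $Y=\{x\in A^\Gamma : gx\notin[p]\ \text{for all } g\in\Gamma,\ p\in\mathcal F\}$ with $A$ a finite alphabet, $\mathcal F$ a finite set of patterns with finite support and $(gx)(h)=x(g^{-1}h)$; and $\Gamma\curvearrowright X$ is a topological factor of $\Gamma\curvearrowright Y$ if there is a continuous surjective $\Gamma$-equivariant map $Y\to X$. Let $X$ be a compact metrizable abelian group on which $\Gamma$ acts by continuous automorphisms (an algebraic action). Its Pontryagin dual $\widehat X$, the group of continuous homomorphisms $X\to\mathbb R/\mathbb Z$, is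 a left $\mathbb Z[\Gamma]$-module through $(g\chi)(x)=\chi(g^{-1}x)$; the action is called finitely generated, respectively finitely presented, if this module is. A finitely generated algebraic action is called recursively presented if there are a finite generating set $S$ of $\Gamma$, an $n\in\mathbb N$ and a computable total map $q\colon\mathbb N\to\mathbb Z[S^*]^n$, where $\mathbb Z[S^*]$ is the set of finitely supported maps $S^*\to\mathbb Z$, such that the action is isomorphic (through a $\Gamma$-equivariant isomorphism of topological groups) to the shift action $(gx)_i(h)=x_i(g^{-1}h)$ on $$\Big\{(x_1,\dots,x_n)\in\big((\mathbb R/\mathbb Z)^{\Gamma}\big)^n : \sum_{i=1}^n\ \sum_{w\in S^*} q(k)_i(w)\,x_i(h\,\underline w)=0\ \text{ for all } k\in\mathbb N,\ h\in\Gamma\Big\}.$$ Then: 1. if the algebraic action $\Gamma\curvearrowright X$ is finitely presented, it is a topological factor of a $\Gamma$-subshift of finite type; 2. more generally, if the algebraic action $\Gamma\curvearrowright X$ is recursively presented, it is a topological factor of a $\Gamma$-subshift of finite type. -/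

import Mathlib

noncomputable section

namespace AlgSFT

/-! ### Finitely generated groups and recursive presentations -/

/-- The element of `Γ` represented by a word over the alphabet `Fin m`, the letter `i` standing
for the group element `s i`. -/
def evalWord {Γ : Type*} [Group Γ] {m : ℕ} (s : Fin m → Γ) (w : List (Fin m)) : Γ :=
  (w.map s).prod

/-- The finite family `s` generates `Γ`: every element of `Γ` is represented by a word in it. -/
def Generates {Γ : Type*} [Group Γ] {m : ℕ} (s : Fin m → Γ) : Prop :=
  ∀ g : Γ, ∃ w : List (Fin m), evalWord s w = g

/-- `Γ` is recursively presented: for a finite family of generators, the word problem (the set of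
words representing the identity) is recursively enumerable. -/
def IsRecursivelyPresentedGroup (Γ : Type*) [Group Γ] : Prop :=
  ∃ (m : ℕ) (s : Fin m → Γ), Generates s ∧
    REPred fun w : List (Fin m) => evalWord s w = 1

/-! ### Subshifts of finite type and their topological factors -/

/-- The left shift `(g x)(h) = x (g⁻¹ h)`. -/
def shift {Γ : Type*} [Group Γ] {A : Type*} (g : Γ) (x : Γ → A) : Γ → A :=
  fun h => x (g⁻¹ * h)

/-- A pattern: a finite subset of `Γ` with a symbol of `A` at each of its elements. -/
structure Pattern (Γ A : Type*) where
  support : Finset Γ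
  symbol : support → A

/-- The cylinder of all configurations that extend a pattern. -/
def Pattern.cylinder {Γ A : Type*} (p : Pattern Γ A) : Set (Γ → A) :=
  {x | ∀ h : p.support, x h = p.symbol h}

/-- The subshift defined by a set of forbidden patterns. -/
def avoiding {Γ : Type*} [Group Γ] {A : Type*} (F : Set (Pattern Γ A)) : Set (Γ → A) :=
  {x | ∀ g : Γ, ∀ p ∈ F, shift g x ∉ p.cylinder}

/-- Subshifts of finite type. -/
def IsSFT {Γ : Type*} [Group Γ] {A : Type*} (Y : Set (Γ → A)) : Prop :=
  ∃ F : Set (Pattern Γ A), F.Finite ∧ Y = avoiding F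

theorem IsSFT.shift_mem {Γ : Type*} [Group Γ] {A : Type*} {Y : Set (Γ → A)} (hY : IsSFT Y)
    (g : Γ) {y : Γ → A} (hy : y ∈ Y) : shift g y ∈ Y := by
  obtain ⟨F, -, rfl⟩ := hY
  intro g' p hp
  have h : shift g' (shift g y) = shift (g' * g) y := by
    funext k
    simp [shift, mul_assoc]
  rw [h]
  exact hy (g' * g) p hp

/-- The action of `Γ` on `X` is a topological factor of a `Γ`-subshift of finite type: for some
finite alphabet (with the discrete topology) and some subshift of finite type `Y` over it, there is
a continuous surjective `Γ`-equivariant map from `Y` to `X`. -/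
def IsFactorOfSFT (Γ : Type*) [Group Γ] (X : Type*) [TopologicalSpace X] [MulAction Γ X] : Prop :=
  ∃ (a : ℕ) (Y : Set (Γ → Fin a)) (hY : IsSFT Y) (f : Y → X),
    Continuous f ∧ Function.Surjective f ∧
      ∀ (g : Γ) (y : Y), f ⟨shift g y, hY.shift_mem g y.2⟩ = g • f y

/-! ### Computability on the Cantor space and self-simulable groups -/

/-- The cylinder of all binary sequences with prefix `w`. -/
def cyl (w : List Bool) : Set (ℕ → Bool) :=
  {x | ∀ i : Fin w.length, x i = w.get i}

/-- Effectively closed subsets of the Cantor space: the complement is the union of the cylinders of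
a recursively enumerable set of words. -/
def IsEffectivelyClosed (X : Set (ℕ → Bool)) : Prop :=
  ∃ L : List Bool → Prop, REPred L ∧ Xᶜ = ⋃ w ∈ {w | L w}, cyl w

/-- Computable maps from a subset of the Cantor space to the Cantor space: the preimage of the
cylinder of `w` is, uniformly in `w`, the trace of an effectively open set. -/
def IsComputableMap {X : Set (ℕ → Bool)} (f : X → (ℕ → Bool)) : Prop :=
  ∃ L : List Bool × List Bool → Prop, REPred L ∧
    ∀ w : List Bool, f ⁻¹' cyl w = Subtype.val ⁻¹' ⋃ v ∈ {v | L (w, v)}, cyl v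

/-- Computable actions on a subset of the Cantor space: the elements of some finite generating
family act by computable maps. -/
def IsComputableAction (H : Type*) [Group H] (X : Set (ℕ → Bool)) [MulAction H X] : Prop :=
  ∃ (m : ℕ) (s : Fin m → H), Generates s ∧
    ∀ i : Fin m, IsComputableMap fun x : X => ((s i • x : X) : ℕ → Bool)

/-- `Γ` simulates `H` through `ψ`: for every computable action of `H` on an effectively closed
subset of the Cantor space, the action of `Γ` induced through `ψ` is a topological factor of a
`Γ`-subshift of finite type. -/
def Simulates {Γ H : Type*} [Group Γ] [Group H] (ψ : Γ →* H) : Prop :=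
  ∀ X : Set (ℕ → Bool), IsEffectivelyClosed X →
    ∀ _act : MulAction H X, IsComputableAction H X →
      @IsFactorOfSFT Γ _ X _ (MulAction.compHom X ψ)

/-- `Γ` is self-simulable: it simulates itself (through the identity). -/
def IsSelfSimulable (Γ : Type*) [Group Γ] : Prop :=
  Simulates (MonoidHom.id Γ)

/-! ### Algebraic actions and the dual module -/

section Dual

variable (Γ : Type*) [Group Γ] (X : Type*) [AddCommGroup X] [TopologicalSpace X]
  [DistribMulAction Γ X] [ContinuousConstSMul Γ X]

/-- The translate `g χ` of a character: `(g χ)(x) = χ (g⁻¹ x)`. -/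
def translate (g : Γ) (χ : X →ₜ+ UnitAddCircle) : X →ₜ+ UnitAddCircle where
  toFun x := χ (g⁻¹ • x)
  map_zero' := by simp
  map_add' x y := by simp
  continuous_toFun := χ.continuous_toFun.comp (continuous_const_smul g⁻¹)

/-- The action of `Γ` on the group of continuous characters of `X`. -/
def dualRep : Representation ℤ Γ (X →ₜ+ UnitAddCircle) where
  toFun g := AddMonoidHom.toIntLinearMap
    { toFun := translate Γ X g
      map_zero' := by ext x; rfl
      map_add' := fun χ χ' => by ext x; rfl }
  map_one' := by
    ext χ x
    change χ ((1 : Γ)⁻¹ • x) = χ x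
    simp
  map_mul' g h := by
    ext χ x
    change χ ((g * h)⁻¹ • x) = χ (h⁻¹ • g⁻¹ • x)
    simp [mul_smul]

/-- The left `ℤ[Γ]`-module associated to an algebraic action of `Γ` on `X`: the Pontryagin dual of
`X`, on which `∑ cᵢ gᵢ` acts by `χ ↦ ∑ cᵢ (gᵢ χ)`. -/
abbrev DualModule : Type _ := (dualRep Γ X).asModule

/-- Finitely generated algebraic actions. -/
def IsFinitelyGeneratedAction : Prop :=
  Module.Finite (MonoidAlgebra ℤ Γ) (DualModule Γ X)

/-- Finitely presented algebraic actions. -/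
def IsFinitelyPresentedAction : Prop :=
  Module.FinitePresentation (MonoidAlgebra ℤ Γ) (DualModule Γ X)

end Dual

/-! ### Recursively presented algebraic actions -/

/-- For `x : Γ → ℝ/ℤ` and `p = ∑ cᵢ gᵢ` in `ℤ[Γ]`, the product
`x p*`, that is `(x p*)(h) = ∑ cᵢ x (h gᵢ)`. -/
def mulStar {Γ : Type*} [Group Γ] (x : Γ → UnitAddCircle) (p : MonoidAlgebra ℤ Γ) :
    Γ → UnitAddCircle :=
  fun h => p.coeff.sum fun g c => c • x (h * g)

/-- The element of `ℤ[Γ]` represented by a finitely supported map from words to `ℤ`. -/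
def evalRing {Γ : Type*} [Group Γ] {m : ℕ} (s : Fin m → Γ) (p : List (Fin m) →₀ ℤ) :
    MonoidAlgebra ℤ Γ :=
  p.sum fun w c => MonoidAlgebra.single (evalWord s w) c

/-- The finitely supported map from words to `ℤ` named by a list of monomials. -/
def ofMonomials {m : ℕ} (l : List (List (Fin m) × ℤ)) : List (Fin m) →₀ ℤ :=
  (l.map fun t => Finsupp.single t.1 t.2).sum

/-- Computable total maps from `ℕ` to `ℤ[S*]ⁿ`, an element of `ℤ[S*]` being named by a list of
monomials whose sum it is. -/
def IsComputableFamily {m n : ℕ} (g : ℕ → Fin n → (List (Fin m) →₀ ℤ)) : Prop :=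
  ∃ c : ℕ → Fin n → List (List (Fin m) × ℤ), Computable c ∧
    ∀ k i, g k i = ofMonomials (c k i)

/-- The closed shift-invariant subgroup of `((ℝ/ℤ)^Γ)ⁿ` defined by a sequence of equations. -/
def solutions {Γ : Type*} [Group Γ] {n : ℕ} (p : ℕ → Fin n → MonoidAlgebra ℤ Γ) :
    AddSubgroup (Fin n → Γ → UnitAddCircle) where
  carrier := {x | ∀ k, ∑ i, mulStar (x i) (p k i) = 0}
  zero_mem' k := by
    refine Finset.sum_eq_zero fun i _ => funext fun h => ?_
    simp [mulStar, Finsupp.sum]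
  add_mem' {x y} hx hy k := by
    have h : ∀ i, mulStar ((x + y) i) (p k i) = mulStar (x i) (p k i) + mulStar (y i) (p k i) :=
      fun i => funext fun h => by simp [mulStar, Finsupp.sum, Finset.sum_add_distrib]
    simp only [h, Finset.sum_add_distrib]
    rw [hx k, hy k, add_zero]
  neg_mem' {x} hx k := by
    have h : ∀ i, mulStar ((-x) i) (p k i) = -mulStar (x i) (p k i) :=
      fun i => funext fun h => by simp [mulStar, Finsupp.sum]
    simp only [h, Finset.sum_neg_distrib]
    rw [hx k, neg_zero]

/-- Recursively presented algebraic actions: finitely generated algebraic actions that are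
isomorphic, as topological groups with an action of `Γ`, to the shift action on the subgroup of
`((ℝ/ℤ)^Γ)ⁿ` defined by a computable sequence of equations. -/
def IsRecursivelyPresentedAction (Γ : Type*) [Group Γ] (X : Type*) [AddCommGroup X]
    [TopologicalSpace X] [DistribMulAction Γ X] [ContinuousConstSMul Γ X] : Prop :=
  IsFinitelyGeneratedAction Γ X ∧
    ∃ (m : ℕ) (s : Fin m → Γ) (n : ℕ) (g : ℕ → Fin n → (List (Fin m) →₀ ℤ)),
      Generates s ∧ IsComputableFamily g ∧
        ∃ e : X ≃ₜ+ solutions fun k i => evalRing s (g k i),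
          ∀ (γ : Γ) (x : X) (i : Fin n), (e (γ • x)).1 i = shift γ ((e x).1 i)

end AlgSFT

end

set_option linter.all false

/-! For a recursively presented action, a solution `x` is stored as one binary sequence: the digits
of each `x_i` at every group element, indexed by words instead of elements of `Γ`. Two conditions
cut out the set `codes` of such sequences. Words naming the same element must carry the same digits;
equality of words is recursively enumerable, so a violation is eventually found. Every equation must
hold at every word; by `realSum_coe_eq_zero_iff`, a failure modulo 1 already shows in finitely many
digits. Hence `codes` is effectively closed. `Γ` acts on it by concatenating a word on the left of
the index, a computable change of positions, so self-simulability makes it a factor of a subshift of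
finite type. Reading digits as points of ℝ/ℤ is continuous, equivariant and onto the solutions; it
is not injective, but a factor map need not be.

Finitely presented actions reduce to this case by Pontryagin duality. Generators χ_i of the dual,
with module of relations `K`, send `x` to `h ↦ χ_i (h⁻¹ x)`, which satisfies the finitely many
equations spanning `K`. This map is injective because characters separate points
(`exists_continuousMonoidHom_circle_ne_one`). It is onto because a solution outside the compact
image would be separated from it by an integer combination of coordinates
(`TorusDuality.exists_combination_ne_zero`); a combination vanishing on the image is a relation, so
the solution satisfies it too.

Separation of points comes from Gelfand theory for a commutative C*-algebra containing the
translations of L²; separation from a subgroup comes from Stone–Weierstrass and Haar averaging. -/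

section

open MeasureTheory DomMulAct

noncomputable section

/-! ### Characters of compact abelian groups through the Gelfand transform. -/

namespace CompactAbelianGroup

variable {G : Type*} [CommGroup G] [TopologicalSpace G] [IsTopologicalGroup G] [CompactSpace G]
  [T2Space G] [MeasurableSpace G] [BorelSpace G] (μ : Measure G) [μ.IsHaarMeasure] [μ.Regular]

/-- Translation on `L²(G)`. -/
def translationL2 (x : G) : Lp ℂ 2 μ →L[ℂ] Lp ℂ 2 μ :=
  LinearMap.mkContinuous
    { toFun := fun f => mk x • f
      map_add' := fun f g => smul_add _ f g
      map_smul' := fun c f => smul_comm _ c f } 1 fun f => by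
    simpa using (DomMulAct.norm_smul_Lp (mk x) f).le

theorem translationL2_apply (x : G) (f : Lp ℂ 2 μ) : translationL2 μ x f = mk x • f := rfl

theorem translationL2_one : translationL2 μ (1 : G) = 1 := by
  ext1 f
  simp [translationL2_apply]

theorem translationL2_mul (x y : G) :
    translationL2 μ (x * y) = translationL2 μ x * translationL2 μ y := by
  ext1 f
  rw [mul_apply_eq_comp]
  simp only [translationL2_apply, ← mul_smul, ← mk_mul]
  rw [mul_comm]

theorem norm_translationL2_le (x : G) : ‖translationL2 μ x‖ ≤ 1 :=
  LinearMap.mkContinuous_norm_le _ zero_le_one _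

theorem continuous_translationL2 (f : Lp ℂ 2 μ) : Continuous fun x => translationL2 μ x f := by
  have : Fact ((2 : ENNReal) ≠ ⊤) := ⟨by simp⟩
  exact (continuous_mk (M := G)).smul continuous_const

/-- An invertible isometry is unitary, so its adjoint is its inverse. -/
theorem star_translationL2 (x : G) : star (translationL2 μ x) = translationL2 μ x⁻¹ := by
  have h : star (translationL2 μ x) * translationL2 μ x = 1 :=
    (ContinuousLinearMap.norm_map_iff_adjoint_comp_self _).1
      fun f => DomMulAct.norm_smul_Lp (mk x) f
  have h' : translationL2 μ x * translationL2 μ x⁻¹ = 1 := by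
    rw [← translationL2_mul, mul_inv_cancel, translationL2_one]
  exact left_inv_eq_right_inv h h'

theorem integrable_of_continuous {E : Type*} [NormedAddCommGroup E] {f : G → E}
    (hf : Continuous f) : Integrable f μ :=
  hf.integrable_of_hasCompactSupport (HasCompactSupport.of_compactSpace f)

theorem continuous_smul_translationL2 (g : C(G, ℂ)) (f : Lp ℂ 2 μ) :
    Continuous fun y => g y • translationL2 μ y f :=
  g.continuous.smul (continuous_translationL2 μ f)

/-- The operator `f ↦ ∫ g(y) f(y ·) dy` on `L²(G)`. -/
def averageL2 (g : C(G, ℂ)) : Lp ℂ 2 μ →L[ℂ] Lp ℂ 2 μ :=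
  LinearMap.mkContinuous
    { toFun := fun f => ∫ y, g y • translationL2 μ y f ∂μ
      map_add' := fun f f' => by
        simp only [map_add, smul_add]
        exact integral_add (integrable_of_continuous μ (continuous_smul_translationL2 μ g f))
          (integrable_of_continuous μ (continuous_smul_translationL2 μ g f'))
      map_smul' := fun c f => by
        simp only [map_smul, smul_comm _ c, RingHom.id_apply]
        exact integral_smul c _ } (‖g‖ * μ.real Set.univ) fun f => by
    refine (norm_integral_le_of_norm_le_const (C := ‖g‖ * ‖f‖) (.of_forall fun y => ?_)).trans
      (le_of_eq (by ring))
    rw [norm_smul]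
    exact mul_le_mul (g.norm_coe_le_norm y) (DomMulAct.norm_smul_Lp (mk y) f).le
      (norm_nonneg _) (norm_nonneg _)

theorem averageL2_apply (g : C(G, ℂ)) (f : Lp ℂ 2 μ) :
    averageL2 μ g f = ∫ y, g y • translationL2 μ y f ∂μ := rfl

theorem norm_averageL2_sub_le (g g' : C(G, ℂ)) :
    ‖averageL2 μ g - averageL2 μ g'‖ ≤ ‖g - g'‖ * μ.real Set.univ := by
  have : averageL2 μ g - averageL2 μ g' = averageL2 μ (g - g') := by
    ext1 f
    rw [sub_apply]
    simp only [averageL2_apply]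
    rw [← integral_sub (integrable_of_continuous μ (continuous_smul_translationL2 μ g f))
          (integrable_of_continuous μ (continuous_smul_translationL2 μ g' f))]
    simp [sub_smul]
  rw [this]
  exact LinearMap.mkContinuous_norm_le _ (by positivity) _

theorem commute_averageL2 {B : Lp ℂ 2 μ →L[ℂ] Lp ℂ 2 μ}
    (hB : ∀ x, translationL2 μ x * B = B * translationL2 μ x) (g : C(G, ℂ)) :
    averageL2 μ g * B = B * averageL2 μ g := by
  ext1 f
  simp only [mul_apply_eq_comp, averageL2_apply]
  rw [← ContinuousLinearMap.integral_comp_comm _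
    (integrable_of_continuous μ (continuous_smul_translationL2 μ g f))]
  refine integral_congr_ae (.of_forall fun y => ?_)
  simpa using congrArg (g y • ·) (DFunLike.congr_fun (hB y) f)

/-- The translate of a continuous function. -/
def translateFun (g : C(G, ℂ)) (x : G) : C(G, ℂ) :=
  g.comp ⟨fun y => x⁻¹ * y, by fun_prop⟩

theorem continuous_translateFun (g : C(G, ℂ)) : Continuous (translateFun g) :=
  (ContinuousMap.curry ⟨fun p : G × G => g (p.1⁻¹ * p.2), by fun_prop⟩).continuous

/-- Invariance of Haar measure moves the translation from the function to the kernel. -/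
theorem translationL2_mul_averageL2 (g : C(G, ℂ)) (x : G) :
    translationL2 μ x * averageL2 μ g = averageL2 μ (translateFun g x) := by
  ext1 f
  simp only [mul_apply_eq_comp, averageL2_apply]
  rw [← ContinuousLinearMap.integral_comp_comm _
    (integrable_of_continuous μ (continuous_smul_translationL2 μ g f)),
    ← integral_mul_left_eq_self (μ := μ) (fun y => translateFun g x y • translationL2 μ y f) x]
  refine integral_congr_ae (.of_forall fun y => ?_)
  simp [translateFun, translationL2_mul]

/-- Translations alone are only shown to be strongly continuous. After averaging, `x` enters only
through the kernel, which varies continuously in sup norm, and the average is Lipschitz in its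
kernel. This gives the norm continuity that makes characters of the algebra continuous on `G`. -/
theorem continuous_translationL2_mul_averageL2 (g : C(G, ℂ)) :
    Continuous fun x => translationL2 μ x * averageL2 μ g := by
  simp only [translationL2_mul_averageL2]
  have : Continuous (averageL2 μ) := by
    have h : LipschitzWith (μ.real Set.univ).toNNReal (averageL2 μ) :=
      LipschitzWith.of_dist_le_mul fun g g' => by
        rw [dist_eq_norm, dist_eq_norm, mul_comm, Real.coe_toNNReal _ (by positivity)]
        exact norm_averageL2_sub_le μ g g'
    exact h.continuous
  exact this.comp (continuous_translateFun g)

theorem exists_translationL2_ne {x : G} (hx : x ≠ 1) :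
    ∃ f : Lp ℂ 2 μ, translationL2 μ x f ≠ f := by
  obtain ⟨u, h0, h1, -⟩ := exists_continuous_zero_one_of_isClosed (X := G) isClosed_singleton
    isClosed_singleton (Set.disjoint_singleton.2 hx.symm)
  have hu : Continuous fun y => (u y : ℂ) := by fun_prop
  have hm : MemLp (fun y => (u y : ℂ)) 2 μ :=
    hu.memLp_of_hasCompactSupport (HasCompactSupport.of_compactSpace _)
  refine ⟨hm.toLp, fun h => ?_⟩
  rw [translationL2_apply, mk_smul_toLp, MemLp.toLp_eq_toLp_iff] at h
  have h2 := congrFun ((Continuous.ae_eq_iff_eq μ (by fun_prop) hu).1 h) 1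
  have e0 : u 1 = 0 := h0 rfl
  have e1 : u x = 1 := h1 rfl
  simp [e0, e1] at h2

/-- Approximate identity: the kernel is a bump of integral 1 supported where translation moves `f`
by less than `ε`. -/
theorem exists_averageL2_sub_lt (f : Lp ℂ 2 μ) {ε : ℝ} (hε : 0 < ε) :
    ∃ g : C(G, ℂ), ‖averageL2 μ g f - f‖ ≤ ε := by
  have hV : IsOpen {y | ‖translationL2 μ y f - f‖ < ε} :=
    isOpen_lt (((continuous_translationL2 μ f).sub continuous_const).norm) continuous_const
  obtain ⟨u, h0, h1, h01⟩ := exists_continuous_zero_one_of_isClosed (X := G) hV.isClosed_compl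
    (isClosed_singleton (x := (1 : G))) (by
      rw [Set.disjoint_singleton_right]
      simpa [translationL2_one] using hε)
  have e1 : u 1 = 1 := h1 rfl
  have hI : 0 < ∫ y, u y ∂μ :=
    u.continuous.integral_pos_of_hasCompactSupport_nonneg_nonzero
      (HasCompactSupport.of_compactSpace _) (fun y => (h01 y).1) (x := 1) (by simp [e1])
  set I := ∫ y, u y ∂μ with hIdef
  let g : C(G, ℂ) := ⟨fun y => ((u y / I : ℝ) : ℂ), by fun_prop⟩
  have hg : ∫ y, g y ∂μ = 1 := by
    change ∫ y, ((u y / I : ℝ) : ℂ) ∂μ = 1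
    rw [integral_complex_ofReal, integral_div, ← hIdef, div_self hI.ne', Complex.ofReal_one]
  refine ⟨g, ?_⟩
  have h2 : averageL2 μ g f - f = ∫ y, g y • (translationL2 μ y f - f) ∂μ := by
    simp only [smul_sub]
    rw [integral_sub (integrable_of_continuous μ (continuous_smul_translationL2 μ g f))
      (integrable_of_continuous μ (by fun_prop)), integral_smul_const, hg, one_smul,
      averageL2_apply]
  rw [h2]
  have h3 : ∫ y, u y / I * ε ∂μ = ε := by
    rw [integral_mul_const, integral_div, ← hIdef, div_self hI.ne', one_mul]
  rw [← h3]
  refine norm_integral_le_of_norm_le (integrable_of_continuous μ (by fun_prop))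
    (.of_forall fun y => ?_)
  have hgy : ‖g y‖ = u y / I := by
    change ‖((u y / I : ℝ) : ℂ)‖ = _
    rw [Complex.norm_real, Real.norm_of_nonneg (div_nonneg (h01 y).1 hI.le)]
  rw [norm_smul, hgy]
  by_cases hy : ‖translationL2 μ y f - f‖ < ε
  · exact mul_le_mul_of_nonneg_left hy.le (div_nonneg (h01 y).1 hI.le)
  · have : u y = 0 := h0 hy
    simp [this]

theorem exists_translationL2_mul_averageL2_ne {x : G} (hx : x ≠ 1) :
    ∃ g : C(G, ℂ), translationL2 μ x * averageL2 μ g ≠ averageL2 μ g := by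
  obtain ⟨f, hf⟩ := exists_translationL2_ne μ hx
  by_contra! h
  have h0 : 0 < ‖translationL2 μ x f - f‖ := norm_pos_iff.2 (sub_ne_zero.2 hf)
  -- Two error terms of equal norm will bound the displacement of `f`, so a third of it is small
  -- enough.
  obtain ⟨g, hg⟩ := exists_averageL2_sub_lt μ f (ε := ‖translationL2 μ x f - f‖ / 3) (by positivity)
  have h1 : translationL2 μ x f - f =
      (averageL2 μ g f - f) - translationL2 μ x (averageL2 μ g f - f) := by
    have := DFunLike.congr_fun (h g) f
    rw [mul_apply_eq_comp] at this
    rw [map_sub, this]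
    abel
  have h2 : ‖translationL2 μ x (averageL2 μ g f - f)‖ = ‖averageL2 μ g f - f‖ :=
    DomMulAct.norm_smul_Lp (mk x) _
  have := norm_sub_le (averageL2 μ g f - f) (translationL2 μ x (averageL2 μ g f - f))
  rw [← h1, h2] at this
  linarith

/-- The commutative C*-algebra generated by the translations, as a double centralizer. -/
def translationAlgebra : StarSubalgebra ℂ (Lp ℂ 2 μ →L[ℂ] Lp ℂ 2 μ) :=
  StarSubalgebra.centralizer ℂ
    (StarSubalgebra.centralizer ℂ (Set.range (translationL2 μ)) : Set (Lp ℂ 2 μ →L[ℂ] Lp ℂ 2 μ))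

theorem translationL2_mem_centralizer (x : G) :
    translationL2 μ x ∈ StarSubalgebra.centralizer ℂ (Set.range (translationL2 μ)) := by
  rw [StarSubalgebra.mem_centralizer_iff]
  rintro _ ⟨y, rfl⟩
  rw [star_translationL2]
  simp only [← translationL2_mul, mul_comm x, and_self]

/-- The adjoint half of the centralizer condition is automatic, because the centralizer of the
translations is itself closed under adjoints. -/
theorem mem_translationAlgebra {T : Lp ℂ 2 μ →L[ℂ] Lp ℂ 2 μ}
    (hT : ∀ B, (∀ x, translationL2 μ x * B = B * translationL2 μ x) → B * T = T * B) :
    T ∈ translationAlgebra μ := by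
  have key : ∀ B ∈ StarSubalgebra.centralizer ℂ (Set.range (translationL2 μ)), B * T = T * B :=
    fun B hB => hT B fun x =>
      ((StarSubalgebra.mem_centralizer_iff ℂ).1 hB _ ⟨x, rfl⟩).1
  rw [translationAlgebra, StarSubalgebra.mem_centralizer_iff]
  exact fun B hB => ⟨key B hB, key _ (star_mem hB)⟩

theorem translationL2_mem (x : G) : translationL2 μ x ∈ translationAlgebra μ :=
  mem_translationAlgebra μ fun B hB => (hB x).symm

theorem averageL2_mem (g : C(G, ℂ)) : averageL2 μ g ∈ translationAlgebra μ :=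
  mem_translationAlgebra μ fun B hB => (commute_averageL2 μ hB g).symm

/-- The translations commute, so they lie in their own centralizer; hence the double centralizer is
contained in the centralizer and commutes with itself. -/
theorem mul_comm_of_mem_translationAlgebra {S T : Lp ℂ 2 μ →L[ℂ] Lp ℂ 2 μ}
    (hS : S ∈ translationAlgebra μ) (hT : T ∈ translationAlgebra μ) : S * T = T * S := by
  rw [translationAlgebra, StarSubalgebra.mem_centralizer_iff] at hS hT
  refine (hT S ?_).1
  refine (StarSubalgebra.mem_centralizer_iff ℂ).2 ?_
  rintro _ ⟨x, rfl⟩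
  exact hS _ (translationL2_mem_centralizer μ x)

theorem isClosed_translationAlgebra :
    IsClosed (translationAlgebra μ : Set (Lp ℂ 2 μ →L[ℂ] Lp ℂ 2 μ)) := by
  rw [translationAlgebra, StarSubalgebra.coe_centralizer]
  exact Set.isClosed_centralizer _

instance : CommCStarAlgebra (translationAlgebra μ) :=
  { StarSubalgebra.cstarAlgebra (translationAlgebra μ)
      (h_closed := isClosed_translationAlgebra μ) with
    mul_comm := fun S T => Subtype.ext (mul_comm_of_mem_translationAlgebra μ S.2 T.2) }

theorem exists_character_ne_zero {T : translationAlgebra μ} (hT : T ≠ 0) :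
    ∃ φ : WeakDual.characterSpace ℂ (translationAlgebra μ), φ T ≠ 0 := by
  by_contra! h
  refine hT ((gelfandTransform_isometry (translationAlgebra μ)).injective ?_)
  ext φ
  simpa using h φ

/-- The values at `x` and `x⁻¹` have norm at most 1 and product 1. -/
theorem norm_character_translationL2 (φ : WeakDual.characterSpace ℂ (translationAlgebra μ))
    (x : G) : ‖φ ⟨translationL2 μ x, translationL2_mem μ x⟩‖ = 1 := by
  have hle : ∀ y : G, ‖φ ⟨translationL2 μ y, translationL2_mem μ y⟩‖ ≤ 1 := fun y => by
    refine (AlgHom.norm_apply_le_self_mul_norm_one (WeakDual.CharacterSpace.toAlgHom φ) _).trans ?_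
    exact mul_le_one₀ (norm_translationL2_le μ y) (norm_nonneg _) ContinuousLinearMap.norm_id_le
  have h1 : φ ⟨translationL2 μ x, translationL2_mem μ x⟩ *
      φ ⟨translationL2 μ x⁻¹, translationL2_mem μ x⁻¹⟩ = 1 := by
    rw [← map_mul, ← map_one φ]
    congr 1
    apply Subtype.ext
    change translationL2 μ x * translationL2 μ x⁻¹ = 1
    rw [← translationL2_mul, mul_inv_cancel, translationL2_one]
  have h2 := congrArg norm h1
  rw [norm_mul, norm_one] at h2
  refine le_antisymm (hle x) ?_
  nlinarith [hle x, hle x⁻¹, norm_nonneg (φ ⟨translationL2 μ x, translationL2_mem μ x⟩)]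

end CompactAbelianGroup

open CompactAbelianGroup in
/-- Continuous characters separate the points of a compact abelian group. -/
theorem exists_continuousMonoidHom_circle_ne_one {G : Type*} [CommGroup G] [TopologicalSpace G]
    [IsTopologicalGroup G] [CompactSpace G] [T2Space G] {x : G} (hx : x ≠ 1) :
    ∃ χ : G →ₜ* Circle, χ x ≠ 1 := by
  borelize G
  let μ : Measure G := Measure.haar
  obtain ⟨g, hg⟩ := exists_translationL2_mul_averageL2_ne μ hx
  let U : G → translationAlgebra μ := fun y => ⟨translationL2 μ y, translationL2_mem μ y⟩
  let T : translationAlgebra μ := ⟨averageL2 μ g, averageL2_mem μ g⟩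
  -- Nonvanishing on `U x * T - T` gives both `φ T ≠ 0` and `φ (U x) ≠ 1`.
  obtain ⟨φ, hφ⟩ := exists_character_ne_zero μ (T := U x * T - T)
    (sub_ne_zero.2 fun h => hg (congrArg Subtype.val h))
  rw [map_sub, map_mul, sub_ne_zero] at hφ
  have hT : φ T ≠ 0 := fun h => hφ (by rw [h, mul_zero])
  have hU : ∀ y z, U (y * z) = U y * U z := fun y z => Subtype.ext (translationL2_mul μ y z)
  have hU1 : U 1 = 1 := Subtype.ext (translationL2_one μ)
  have hc : Continuous fun y => φ (U y) := by
    have h1 : Continuous fun y => φ (U y * T) := (map_continuous φ).comp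
      (Continuous.subtype_mk (continuous_translationL2_mul_averageL2 μ g) _)
    -- Dividing by `φ T` transfers the norm continuity of `U y * T` to the character.
    have h2 : (fun y => φ (U y)) = fun y => φ (U y * T) / φ T := by
      funext y
      rw [map_mul, mul_div_cancel_right₀ _ hT]
    rw [h2]
    exact h1.div_const _
  let χ : G →ₜ* Circle :=
    { toFun := fun y => ⟨φ (U y), mem_sphere_zero_iff_norm.2 (norm_character_translationL2 μ φ y)⟩
      map_one' := Subtype.ext (by simp [hU1])
      map_mul' := fun y z => Subtype.ext ((congrArg φ (hU y z)).trans (map_mul φ _ _))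
      continuous_toFun := hc.subtype_mk _ }
  refine ⟨χ, fun h => hφ ?_⟩
  have : φ (U x) = 1 := congrArg Subtype.val h
  rw [this, one_mul]

end

end

noncomputable section

open MeasureTheory

/-! ### Separating points of a torus from compact subgroups. -/

namespace TorusDuality

variable {I : Type*}

/-- The homomorphism `t ↦ ∑ cᵢ tᵢ` on a torus. -/
def combination (c : I →₀ ℤ) : (I → UnitAddCircle) →+ UnitAddCircle where
  toFun t := c.sum fun i k => k • t i
  map_zero' := by simp [Finsupp.sum]
  map_add' t t' := by simp [Finsupp.sum, Finset.sum_add_distrib]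

theorem continuous_combination (c : I →₀ ℤ) : Continuous (combination c) := by
  change Continuous fun t : I → UnitAddCircle => ∑ i ∈ c.support, c i • t i
  fun_prop

theorem combination_add (c c' : I →₀ ℤ) (t : I → UnitAddCircle) :
    combination (c + c') t = combination c t + combination c' t :=
  Finsupp.sum_add_index' (h := fun i k => k • t i) (fun _ => zero_smul ..) fun _ _ _ => add_smul ..

/-- The continuous function `t ↦ exp (2πi ∑ cᵢ tᵢ)`. -/
def trigMonomial : Multiplicative (I →₀ ℤ) →* C(I → UnitAddCircle, ℂ) where
  toFun c := ⟨fun t => (AddCircle.toCircle (combination c.toAdd t) : ℂ), by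
    have := continuous_combination c.toAdd
    have h2 := AddCircle.continuous_toCircle (T := (1 : ℝ))
    exact continuous_subtype_val.comp (h2.comp this)⟩
  map_one' := by
    ext t
    simp [combination]
  map_mul' c c' := by
    ext t
    simp [combination_add, AddCircle.toCircle_add]

theorem trigMonomial_apply (c : I →₀ ℤ) (t : I → UnitAddCircle) :
    trigMonomial (.ofAdd c) t = AddCircle.toCircle (combination c t) := rfl

theorem trigMonomial_apply_add (c : I →₀ ℤ) (t t' : I → UnitAddCircle) :
    trigMonomial (.ofAdd c) (t + t') = trigMonomial (.ofAdd c) t * trigMonomial (.ofAdd c) t' := by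
  simp [trigMonomial_apply, AddCircle.toCircle_add]

/-- Trigonometric polynomials. -/
def trigPolynomials : StarSubalgebra ℂ C(I → UnitAddCircle, ℂ) where
  toSubalgebra := Algebra.adjoin ℂ (Set.range trigMonomial)
  star_mem' := by
    change Algebra.adjoin ℂ (Set.range (trigMonomial (I := I))) ≤
      star (Algebra.adjoin ℂ (Set.range (trigMonomial (I := I))))
    refine Algebra.adjoin_le ?_
    rintro - ⟨c, rfl⟩
    refine Algebra.subset_adjoin ⟨c⁻¹, ?_⟩
    ext1 t
    have : trigMonomial c⁻¹ t * trigMonomial c t = 1 := by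
      rw [← ContinuousMap.mul_apply, ← map_mul, inv_mul_cancel, map_one, ContinuousMap.one_apply]
    rw [eq_inv_of_mul_eq_one_left this, ContinuousMap.star_apply]
    change (↑(AddCircle.toCircle (combination c.toAdd t)) : ℂ)⁻¹ = star (_ : ℂ)
    rw [← Circle.coe_inv, Circle.coe_inv_eq_conj]
    rfl

theorem coe_trigPolynomials : (trigPolynomials (I := I) : Set C(I → UnitAddCircle, ℂ)) =
    (Submodule.span ℂ (Set.range (trigMonomial (I := I))) : Submodule ℂ _) := by
  change (Subalgebra.toSubmodule (Algebra.adjoin ℂ (Set.range (trigMonomial (I := I)))) :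
    Set C(I → UnitAddCircle, ℂ)) = _
  rw [Algebra.adjoin_eq_span_of_subset]
  refine Set.Subset.trans ?_ Submodule.subset_span
  exact (Submonoid.closure_eq (MonoidHom.mrange (trigMonomial (I := I)))).le

/-- Stone–Weierstrass; the monomials of single coordinates already separate points. -/
theorem trigPolynomials_dense :
    (trigPolynomials (I := I)).topologicalClosure = ⊤ := by
  refine ContinuousMap.starSubalgebra_topologicalClosure_eq_top_of_separatesPoints _ ?_
  intro t t' h
  obtain ⟨i, hi⟩ := Function.ne_iff.1 h
  refine ⟨_, ⟨trigMonomial (.ofAdd (Finsupp.single i 1)), Algebra.subset_adjoin ⟨_, rfl⟩, rfl⟩, ?_⟩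
  change trigMonomial (.ofAdd (Finsupp.single i 1)) t ≠ trigMonomial (.ofAdd (Finsupp.single i 1)) t'
  rw [trigMonomial_apply, trigMonomial_apply]
  intro h2
  apply hi
  simpa [combination] using AddCircle.injective_toCircle one_ne_zero (Subtype.ext h2)

variable {X : Type*} [AddCommGroup X] [TopologicalSpace X] [IsTopologicalAddGroup X]
  [CompactSpace X]

/-- A point of a torus outside a compact subgroup is separated from it by an integer combination of
the coordinates. -/
theorem exists_combination_ne_zero (π : X →+ (I → UnitAddCircle)) (hπ : Continuous π)
    {z : I → UnitAddCircle} (hz : z ∉ Set.range π) :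
    ∃ c : I →₀ ℤ, (∀ x, combination c (π x) = 0) ∧ combination c z ≠ 0 := by
  by_contra! hc
  borelize X
  let μ : Measure X := Measure.addHaar
  have hint : ∀ {f : X → ℂ}, Continuous f → Integrable f μ := fun hf =>
    hf.integrable_of_hasCompactSupport (HasCompactSupport.of_compactSpace _)
  -- `Λ` is the Haar average over the image minus the average over its translate by `z`. If no
  -- combination separated `z`, it would vanish on all monomials, hence identically, contradicting a
  -- Urysohn function for the two disjoint compact sets.
  let Λ : C(I → UnitAddCircle, ℂ) →L[ℂ] ℂ := LinearMap.mkContinuous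
    { toFun := fun f => ∫ x, (f (π x) - f (π x + z)) ∂μ
      map_add' := fun f g => by
        rw [← integral_add (hint (by fun_prop)) (hint (by fun_prop))]
        refine integral_congr_ae (.of_forall fun x => ?_)
        simp only [ContinuousMap.add_apply]
        ring
      map_smul' := fun a f => by
        simp only [ContinuousMap.smul_apply, ← smul_sub, RingHom.id_apply]
        exact integral_smul a _ } (2 * μ.real Set.univ) fun f => by
    refine (norm_integral_le_of_norm_le_const (C := 2 * ‖f‖) (.of_forall fun x => ?_)).trans
      (le_of_eq (by ring))
    refine (norm_sub_le _ _).trans ?_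
    linarith [f.norm_coe_le_norm (π x), f.norm_coe_le_norm (π x + z)]
  have hΛ : ∀ f, Λ f = ∫ x, (f (π x) - f (π x + z)) ∂μ := fun f => rfl
  have hmono : ∀ c, Λ (trigMonomial (.ofAdd c)) = 0 := by
    intro c
    simp only [hΛ, trigMonomial_apply_add]
    -- A monomial trivial on the image is trivial at `z` by assumption; a nontrivial one has
    -- integral zero over the image by invariance.
    by_cases h : ∀ x, combination c (π x) = 0
    · simp [trigMonomial_apply, h, hc c h]
    · push Not at h
      obtain ⟨x₀, hx₀⟩ := h
      have h0 : ∫ x, trigMonomial (.ofAdd c) (π x) ∂μ = 0 := by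
        have h1 := integral_add_left_eq_self (μ := μ)
          (fun x => trigMonomial (.ofAdd c) (π x)) x₀
        simp only [map_add, trigMonomial_apply_add] at h1
        rw [integral_const_mul] at h1
        have h2 : trigMonomial (.ofAdd c) (π x₀) ≠ 1 := by
          rw [trigMonomial_apply]
          intro h3
          refine hx₀ (AddCircle.injective_toCircle one_ne_zero (Subtype.ext ?_))
          simpa using h3
        by_contra h3
        exact h2 (mul_right_cancel₀ h3 (h1.trans (one_mul _).symm))
      rw [integral_sub (hint (by fun_prop)) (hint (by fun_prop)), integral_mul_const, h0]
      simp
  have hΛ0 : ∀ f, Λ f = 0 := by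
    have hcl : IsClosed {f | Λ f = 0} := isClosed_eq Λ.continuous continuous_const
    have hsub : (trigPolynomials (I := I) : Set _) ⊆ {f | Λ f = 0} := by
      rw [coe_trigPolynomials]
      refine Submodule.span_le (p := LinearMap.ker Λ.toLinearMap).2 ?_
      rintro _ ⟨c, rfl⟩
      exact hmono c.toAdd
    intro f
    have hf : f ∈ (trigPolynomials (I := I)).topologicalClosure := by
      rw [trigPolynomials_dense]; trivial
    exact closure_minimal hsub hcl hf
  have hcomp : IsCompact (Set.range π) := isCompact_range hπ
  have hcomp' : IsCompact (Set.range fun x => π x + z) :=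
    isCompact_range (hπ.add continuous_const)
  obtain ⟨u, h0, h1, -⟩ := exists_continuous_zero_one_of_isClosed hcomp.isClosed hcomp'.isClosed (by
    rw [Set.disjoint_left]
    rintro _ ⟨x, rfl⟩ ⟨y, hy⟩
    refine hz ⟨x - y, ?_⟩
    rw [map_sub, ← hy]
    simp)
  have h2 := hΛ0 ⟨fun t => (u t : ℂ), by fun_prop⟩
  rw [hΛ] at h2
  have h3 : ∀ x, u (π x) = 0 := fun x => h0 ⟨x, rfl⟩
  have h4 : ∀ x, u (π x + z) = 1 := fun x => h1 ⟨x, rfl⟩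
  simp [h3, h4, Measure.real, ENNReal.toReal_eq_zero_iff, NeZero.ne] at h2

/-- Characters with values in `ℝ/ℤ` separate the points of a compact abelian group. -/
theorem exists_continuousAddMonoidHom_ne_zero [T2Space X] {x : X} (hx : x ≠ 0) :
    ∃ χ : X →ₜ+ UnitAddCircle, χ x ≠ 0 := by
  have : T2Space (Multiplicative X) := ‹T2Space X›
  obtain ⟨χ, hχ⟩ := exists_continuousMonoidHom_circle_ne_one (G := Multiplicative X)
    (x := .ofAdd x) (by simpa using hx)
  let e : UnitAddCircle ≃ₜ Circle := AddCircle.homeomorphCircle one_ne_zero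
  have he : ∀ a, AddCircle.toCircle (e.symm a) = a := fun a => by
    rw [← AddCircle.homeomorphCircle_apply one_ne_zero]
    exact e.apply_symm_apply a
  have hinj := AddCircle.injective_toCircle (T := (1 : ℝ)) one_ne_zero
  let ψ : X →ₜ+ UnitAddCircle :=
    { toFun := fun y => e.symm (χ (.ofAdd y))
      map_zero' := hinj (by rw [he]; simp)
      map_add' := fun y z => hinj (by rw [AddCircle.toCircle_add, he, he, he, ofAdd_add, map_mul])
      continuous_toFun := e.symm.continuous.comp χ.continuous_toFun }
  refine ⟨ψ, fun h => hχ ?_⟩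
  have h' : e.symm (χ (.ofAdd x)) = 0 := h
  rw [← he (χ _), h', AddCircle.toCircle_zero]

end TorusDuality
end

noncomputable section

namespace AlgSFT

/-! ### The group ring acting on circle-valued configurations. -/

section Words

variable {Γ : Type*} [Group Γ]

theorem evalRing_add {m : ℕ} (s : Fin m → Γ) (p q : List (Fin m) →₀ ℤ) :
    evalRing s (p + q) = evalRing s p + evalRing s q :=
  Finsupp.sum_add_index' (fun _ => MonoidAlgebra.single_zero _)
    fun _ _ _ => MonoidAlgebra.single_add _ _ _

theorem ofMonomials_append {m : ℕ} (l l' : List (List (Fin m) × ℤ)) :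
    ofMonomials (l ++ l') = ofMonomials l + ofMonomials l' := by
  simp [ofMonomials]

theorem exists_evalRing_ofMonomials_eq {m : ℕ} {s : Fin m → Γ} (hs : Generates s)
    (p : MonoidAlgebra ℤ Γ) :
    ∃ l : List (List (Fin m) × ℤ), evalRing s (ofMonomials l) = p := by
  induction p using MonoidAlgebra.induction_linear with
  | zero => exact ⟨[], by simp [ofMonomials, evalRing]⟩
  | add p q hp hq =>
    obtain ⟨l, rfl⟩ := hp
    obtain ⟨l', rfl⟩ := hq
    exact ⟨l ++ l', by rw [ofMonomials_append, evalRing_add]⟩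
  | single g c =>
    obtain ⟨w, rfl⟩ := hs g
    exact ⟨[(w, c)], by simp [ofMonomials, evalRing, Finsupp.sum_single_index]⟩

theorem mulStar_zero (x : Γ → UnitAddCircle) : mulStar x 0 = 0 := by
  funext h; simp [mulStar]

theorem mulStar_add (x : Γ → UnitAddCircle) (p q : MonoidAlgebra ℤ Γ) :
    mulStar x (p + q) = mulStar x p + mulStar x q :=
  funext fun h => Finsupp.sum_add_index' (h := fun g (c : ℤ) => c • x (h * g))
    (fun _ => zero_smul ..) fun _ _ _ => add_smul ..

theorem mulStar_single (x : Γ → UnitAddCircle) (g : Γ) (c : ℤ) (h : Γ) :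
    mulStar x (MonoidAlgebra.single g c) h = c • x (h * g) :=
  Finsupp.sum_single_index (h := fun g (c : ℤ) => c • x (h * g)) (zero_smul ..)

/-- Left multiplication by a monomial only moves the point of evaluation to `h * g`, which is why
the equations satisfied by a point form a left submodule. -/
theorem mulStar_single_mul (x : Γ → UnitAddCircle) (g : Γ) (c : ℤ) (p : MonoidAlgebra ℤ Γ)
    (h : Γ) : mulStar x (MonoidAlgebra.single g c * p) h = c • mulStar x p (h * g) := by
  induction p using MonoidAlgebra.induction_linear with
  | zero => simp [mulStar_zero]
  | add p q hp hq => simp only [mul_add, mulStar_add, Pi.add_apply, hp, hq, smul_add]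
  | single g' c' =>
    rw [MonoidAlgebra.single_mul_single, mulStar_single, mulStar_single, mul_smul, mul_assoc]

/-- The equations satisfied by a point of `((ℝ/ℤ)^Γ)ⁿ`. -/
def relations {n : ℕ} (z : Fin n → Γ → UnitAddCircle) :
    Submodule (MonoidAlgebra ℤ Γ) (Fin n → MonoidAlgebra ℤ Γ) where
  carrier := {p | ∑ i, mulStar (z i) (p i) = 0}
  zero_mem' := by simp [mulStar_zero]
  add_mem' {p q} hp hq := by
    have hp' : ∑ i, mulStar (z i) (p i) = 0 := hp
    have hq' : ∑ i, mulStar (z i) (q i) = 0 := hq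
    simp [mulStar_add, Finset.sum_add_distrib, hp', hq']
  smul_mem' a p hp := by
    have hp' : ∑ i, mulStar (z i) (p i) = 0 := hp
    change ∑ i, mulStar (z i) (a * p i) = 0
    induction a using MonoidAlgebra.induction_linear with
    | zero => simp [mulStar_zero]
    | add a b ha hb => simp [add_mul, mulStar_add, Finset.sum_add_distrib, ha, hb]
    | single g c =>
      funext h
      have := congrFun hp' (h * g)
      rw [Finset.sum_apply] at this ⊢
      simp only [mulStar_single_mul, ← Finset.smul_sum]
      rw [this]
      simp

theorem mem_relations {n : ℕ} {z : Fin n → Γ → UnitAddCircle}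
    {p : Fin n → MonoidAlgebra ℤ Γ} : p ∈ relations z ↔ ∑ i, mulStar (z i) (p i) = 0 := Iff.rfl

/-- Translates characters of the torus with index set `Fin n × Γ` into tuples of the group ring,
paired at the identity. -/
theorem exists_sum_mulStar_eq_combination {n : ℕ} (c : Fin n × Γ →₀ ℤ) :
    ∃ p : Fin n → MonoidAlgebra ℤ Γ, ∀ z : Fin n → Γ → UnitAddCircle,
      ∑ i, mulStar (z i) (p i) 1 = TorusDuality.combination c fun j => z j.1 j.2 := by
  induction c using Finsupp.induction_linear with
  | zero => exact ⟨0, fun z => by simp [mulStar_zero, TorusDuality.combination]⟩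
  | add c c' hc hc' =>
    obtain ⟨p, hp⟩ := hc
    obtain ⟨p', hp'⟩ := hc'
    refine ⟨p + p', fun z => ?_⟩
    simp [mulStar_add, Finset.sum_add_distrib, hp, hp', TorusDuality.combination_add]
  | single j k =>
    classical
    refine ⟨Pi.single j.1 (MonoidAlgebra.single j.2 k), fun z => ?_⟩
    rw [Finset.sum_eq_single j.1]
    · simp [mulStar_single, TorusDuality.combination]
    · intro i _ hi
      simp [hi, mulStar_zero]
    · simp

end Words

/-! ### From presentations of the dual module to equations. -/

section DualAction

variable {Γ : Type*} [Group Γ] {X : Type*} [AddCommGroup X] [TopologicalSpace X]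
  [DistribMulAction Γ X] [ContinuousConstSMul Γ X]

/-- The value of a character at a point. -/
def charEval (x : X) : DualModule Γ X →+ UnitAddCircle where
  toFun χ := (dualRep Γ X).asModuleEquiv χ x
  map_zero' := by rw [map_zero]; rfl
  map_add' χ χ' := by rw [map_add]; rfl

theorem charEval_add (x y : X) (χ : DualModule Γ X) :
    charEval (x + y) χ = charEval x χ + charEval y χ :=
  map_add ((dualRep Γ X).asModuleEquiv χ) x y

theorem continuous_charEval (χ : DualModule Γ X) : Continuous fun x : X => charEval x χ :=
  ((dualRep Γ X).asModuleEquiv χ).continuous_toFun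

theorem charEval_single_smul (x : X) (g : Γ) (c : ℤ) (χ : DualModule Γ X) :
    charEval x (MonoidAlgebra.single g c • χ) = c • charEval (g⁻¹ • x) χ := by
  rw [Representation.single_smul]
  exact (map_zsmul (charEval (Γ := Γ) x) c _)

/-- The orbit map of `χ` turns the module structure of the dual into `mulStar`, since `(h g)⁻¹ x =
g⁻¹ h⁻¹ x`. Relations between characters thereby become equations between coordinates. -/
theorem mulStar_charEval (χ : DualModule Γ X) (x : X) (p : MonoidAlgebra ℤ Γ) (h : Γ) :
    mulStar (fun h => charEval (h⁻¹ • x) χ) p h = charEval (h⁻¹ • x) (p • χ) := by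
  induction p using MonoidAlgebra.induction_linear with
  | zero => simp [mulStar_zero]
  | add p q hp hq => simp [mulStar_add, add_smul, hp, hq]
  | single g c => rw [mulStar_single, charEval_single_smul, mul_inv_rev, mul_smul]

theorem IsFinitelyPresentedAction.exists_equiv_solutions [IsTopologicalAddGroup X] [CompactSpace X]
    [T2Space X] (h : IsFinitelyPresentedAction Γ X) :
    ∃ (n : ℕ) (L : List (Fin n → MonoidAlgebra ℤ Γ)),
      ∃ e : X ≃ₜ+ solutions fun k => L.getD k 0,
        ∀ (γ : Γ) (x : X) (i : Fin n), (e (γ • x)).1 i = shift γ ((e x).1 i) := by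
  have : Module.FinitePresentation (MonoidAlgebra ℤ Γ) (DualModule Γ X) := h
  obtain ⟨n, K, e, S, hS⟩ :=
    Module.FinitePresentation.exists_fin (MonoidAlgebra ℤ Γ) (DualModule Γ X)
  let χ : Fin n → DualModule Γ X := fun i => e.symm (K.mkQ (Pi.single i 1))
  have hχ : ∀ p : Fin n → MonoidAlgebra ℤ Γ, ∑ i, p i • χ i = e.symm (K.mkQ p) := fun p => by
    simp only [χ, ← map_smul, ← map_sum]
    congr 2
    funext i
    simp [Finset.sum_apply, Pi.single_apply]
  have hsum : ∀ (x : X) (p : Fin n → MonoidAlgebra ℤ Γ) (h : Γ),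
      ∑ i, mulStar (fun h => charEval (h⁻¹ • x) (χ i)) (p i) h =
        charEval (h⁻¹ • x) (e.symm (K.mkQ p)) := fun x p h => by
    simp only [mulStar_charEval, ← map_sum, hχ]
  let Φ : X →+ (Fin n × Γ → UnitAddCircle) :=
    { toFun := fun x j => charEval (j.2⁻¹ • x) (χ j.1)
      map_zero' := by
        funext j
        simp only [smul_zero]
        exact map_zero ((dualRep Γ X).asModuleEquiv (χ j.1))
      map_add' := fun x y => by
        funext j
        simp only [smul_add, charEval_add, Pi.add_apply] }
  have hΦ : Continuous Φ := continuous_pi fun j =>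
    (continuous_charEval (χ j.1)).comp (continuous_const_smul _)
  have hK : ∀ p ∈ K, ∀ x, p ∈ relations fun i h => charEval (h⁻¹ • x) (χ i) := fun p hp x => by
    rw [mem_relations]
    funext h
    rw [Finset.sum_apply, hsum, Submodule.mkQ_apply, (Submodule.Quotient.mk_eq_zero K).2 hp,
      map_zero, map_zero]
    rfl
  let L := S.toList
  -- `L` spans `K` and the relations of a point form a submodule, so `L` imposes all of `K`; the
  -- default 0 past the end of `L` is the trivial equation.
  have hmem : ∀ z, z ∈ solutions (fun k => L.getD k 0) ↔ ∀ p ∈ K, p ∈ relations z := by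
    intro z
    constructor
    · intro hz
      rw [← hS]
      refine fun p hp => Submodule.span_le.2 ?_ hp
      intro q hq
      obtain ⟨k, hk, rfl⟩ := List.getElem_of_mem (Finset.mem_toList.2 hq)
      have : ∑ i, mulStar (z i) (L.getD k 0 i) = 0 := hz k
      rwa [List.getD_eq_getElem L _ hk] at this
    · intro hz k
      refine hz (L.getD k 0) ?_
      by_cases hk : k < L.length
      · rw [List.getD_eq_getElem _ _ hk, ← hS]
        exact Submodule.subset_span (Finset.mem_toList.1 (List.getElem_mem hk))
      · rw [List.getD_eq_default _ _ (not_lt.1 hk)]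
        exact K.zero_mem
  let ψ : X →+ solutions (fun k => L.getD k 0) :=
    { toFun := fun x => ⟨fun i h => Φ x (i, h), (hmem _).2 fun p hp => hK p hp x⟩
      map_zero' := by
        apply Subtype.ext
        funext i h
        change Φ 0 (i, h) = 0
        rw [map_zero]; rfl
      map_add' := fun x y => by
        apply Subtype.ext
        funext i h
        change Φ (x + y) (i, h) = Φ x (i, h) + Φ y (i, h)
        rw [map_add]; rfl }
  have hψc : Continuous ψ := by
    refine Continuous.subtype_mk ?_ _
    exact continuous_pi fun i => continuous_pi fun h => (continuous_apply (i, h)).comp hΦ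
  have hψi : Function.Injective ψ := by
    rw [injective_iff_map_eq_zero]
    intro x hx
    by_contra hx0
    obtain ⟨η, hη⟩ := TorusDuality.exists_continuousAddMonoidHom_ne_zero hx0
    apply hη
    -- The character `η` is a combination of the generators, all of which vanish along the orbit of
    -- `x`.
    obtain ⟨p, hp⟩ := K.mkQ_surjective (e ((dualRep Γ X).asModuleEquiv.symm η))
    have h1 := hsum x p 1
    rw [hp, LinearEquiv.symm_apply_apply, inv_one, one_smul] at h1
    have h2 : ∀ i, (fun h : Γ => charEval (h⁻¹ • x) (χ i)) = 0 := fun i =>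
      congrFun (congrArg Subtype.val hx) i
    have h3 : ∀ q : MonoidAlgebra ℤ Γ, mulStar (0 : Γ → UnitAddCircle) q = 0 := fun q => by
      funext h; simp [mulStar]
    simp only [h2, h3, Pi.zero_apply, Finset.sum_const_zero] at h1
    exact h1.symm
  have hψs : Function.Surjective ψ := by
    rintro ⟨z, hz⟩
    by_contra hne
    have hz' : (fun j : Fin n × Γ => z j.1 j.2) ∉ Set.range Φ := by
      rintro ⟨x, hx⟩
      refine hne ⟨x, Subtype.ext ?_⟩
      funext i h
      exact congrFun hx (i, h)
    obtain ⟨c, hc, hcz⟩ := TorusDuality.exists_combination_ne_zero Φ hΦ hz'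
    obtain ⟨p, hp⟩ := exists_sum_mulStar_eq_combination c
    -- The class of `p` is the character `x ↦ combination c (Φ x)`, which is zero; so `p` is a
    -- relation, and `z` satisfies it.
    have hpK : p ∈ K := by
      have h0 : e.symm (K.mkQ p) = 0 := by
        refine (dualRep Γ X).asModuleEquiv.injective ?_
        rw [map_zero]
        ext x
        have h1 := hsum x p 1
        rw [hp, inv_one, one_smul] at h1
        exact h1.symm.trans (hc x)
      simpa using h0
    have h2 := congrFun (mem_relations.1 ((hmem z).1 hz p hpK)) 1
    rw [Finset.sum_apply, hp] at h2
    exact hcz h2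
  refine ⟨n, L, ?_, ?_⟩
  · exact
      { AddEquiv.ofBijective ψ ⟨hψi, hψs⟩ with
        continuous_toFun := hψc
        continuous_invFun := (Continuous.homeoOfEquivCompactToT2
          (f := Equiv.ofBijective ψ ⟨hψi, hψs⟩) hψc).continuous_invFun }
  · intro γ x i
    funext h
    change charEval (h⁻¹ • γ • x) (χ i) = charEval ((γ⁻¹ * h)⁻¹ • x) (χ i)
    rw [mul_inv_rev, inv_inv, mul_smul]

/-- Finitely presented algebraic actions are recursively presented. -/
theorem IsFinitelyPresentedAction.isRecursivelyPresentedAction [IsTopologicalAddGroup X]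
    [CompactSpace X] [T2Space X] {m : ℕ} {s : Fin m → Γ} (hs : Generates s)
    (h : IsFinitelyPresentedAction Γ X) : IsRecursivelyPresentedAction Γ X := by
  refine ⟨?_, ?_⟩
  · have : Module.FinitePresentation (MonoidAlgebra ℤ Γ) (DualModule Γ X) := h
    exact inferInstanceAs (Module.Finite (MonoidAlgebra ℤ Γ) (DualModule Γ X))
  obtain ⟨n, L, e, he⟩ := h.exists_equiv_solutions
  choose code hcode using exists_evalRing_ofMonomials_eq hs
  -- Only finitely many words are chosen, so this finite table, extended by empty lists standing for
  -- the zero equation, is primitive recursive.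
  let c : ℕ → Fin n → List (List (Fin m) × ℤ) := fun k =>
    (L.map fun p i => code (p i)).getD k fun _ => []
  have hc : (fun k i => evalRing s (ofMonomials (c k i))) = fun k => L.getD k 0 := by
    funext k i
    by_cases hk : k < L.length
    · simp [c, hk, hcode]
    · simp [c, not_lt.1 hk, ofMonomials, evalRing]
  refine ⟨m, s, n, fun k i => ofMonomials (c k i), hs, ⟨c, ?_, fun _ _ => rfl⟩, ?_⟩
  · exact ((Primrec.list_getD _).comp (Primrec.const _) Primrec.id).to_comp
  · rw [hc]
    exact ⟨e, he⟩

end DualAction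

end AlgSFT
end

/-! ### Recursively enumerable predicates and primitive recursive arithmetic. -/

theorem REPred.comp_computable {α β : Type*} [Primcodable α] [Primcodable β] {p : β → Prop}
    (hp : REPred p) {f : α → β} (hf : Computable f) : REPred fun a => p (f a) :=
  Partrec.comp hp hf

theorem REPred.and {α : Type*} [Primcodable α] {p q : α → Prop} (hp : REPred p) (hq : REPred q) :
    REPred fun a => p a ∧ q a := by
  have h := Partrec.dom_re (Partrec.bind hp (Partrec.comp hq Computable.fst).to₂)
  exact h.of_eq fun a => by simp [Part.assert]

theorem REPred.or {α : Type*} [Primcodable α] {p q : α → Prop} (hp : REPred p) (hq : REPred q) :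
    REPred fun a => p a ∨ q a := by
  obtain ⟨k, hk, H⟩ := Partrec.merge' hp hq
  exact (Partrec.dom_re hk).of_eq fun a => by simpa [Part.assert] using (H a).2

/-- Dovetailing: one search runs over pairs of a step bound for `evaln` and a candidate witness. -/
theorem REPred.exists_nat {α : Type*} [Primcodable α] {p : α × ℕ → Prop} (hp : REPred p) :
    REPred fun a => ∃ n, p (a, n) := by
  obtain ⟨c, hc⟩ := Nat.Partrec.Code.exists_code.1 hp
  have hdom : ∀ x, p x ↔ ∃ k y, y ∈ Nat.Partrec.Code.evaln k c (Encodable.encode x) := by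
    intro x
    have h1 : p x ↔ ((Nat.Partrec.Code.eval c) (Encodable.encode x)).Dom := by
      rw [hc]
      simp [Part.assert]
    rw [h1, Part.dom_iff_mem, exists_comm]
    simp only [Nat.Partrec.Code.evaln_complete]
  have hf : Computable₂ fun (a : α) (j : ℕ) =>
      Nat.Partrec.Code.evaln j.unpair.1 c (Encodable.encode (a, j.unpair.2)) := by
    have hj : Primrec fun x : α × ℕ => x.2.unpair := Primrec.unpair.comp Primrec.snd
    exact (Nat.Partrec.Code.primrec_evaln.comp (((Primrec.fst.comp hj).pair (Primrec.const c)).pair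
      (Primrec.encode.comp (Primrec.fst.pair (Primrec.snd.comp hj))))).to_comp.to₂
  refine (Partrec.dom_re (Partrec.rfindOpt hf)).of_eq fun a => ?_
  rw [Nat.rfindOpt_dom]
  constructor
  · rintro ⟨j, y, hy⟩
    exact ⟨_, (hdom _).2 ⟨_, y, hy⟩⟩
  · rintro ⟨n, hn⟩
    obtain ⟨k, y, hy⟩ := (hdom _).1 hn
    exact ⟨Nat.pair k n, y, by simpa using hy⟩

theorem REPred.exists {α β : Type*} [Primcodable α] [Primcodable β] {p : α × β → Prop}
    (hp : REPred p) : REPred fun a => ∃ b, p (a, b) := by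
  have h : REPred fun x : α × ℕ => ∃ b ∈ Encodable.decode (α := β) x.2, p (x.1, b) := by
    have h1 : Partrec fun x : α × ℕ => (Encodable.decode (α := β) x.2 : Part β).bind fun b =>
        Part.assert (p (x.1, b)) fun _ => Part.some () :=
      Partrec.bind (Computable.ofOption (Computable.decode.comp Computable.snd))
        (Partrec.comp hp ((Computable.fst.comp Computable.fst).pair Computable.snd)).to₂
    refine (Partrec.dom_re h1).of_eq fun x => ?_
    cases h : Encodable.decode (α := β) x.2 <;> simp [Part.assert]
  refine h.exists_nat.of_eq fun a => ?_
  constructor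
  · rintro ⟨n, b, -, hb⟩
    exact ⟨b, hb⟩
  · rintro ⟨b, hb⟩
    exact ⟨Encodable.encode b, b, by simp, hb⟩

/-- The encoding of ℤ sends `k` to `2 * k` and `-(k + 1)` to `2 * k + 1`, so parity gives the sign.
-/
theorem Primrec.int_toNat : Primrec Int.toNat := by
  have h : ∀ z : ℤ, z.toNat = bif (Encodable.encode z).bodd then 0 else (Encodable.encode z).div2 := by
    intro z
    cases z with
    | ofNat k =>
      have : Encodable.encode (Int.ofNat k) = 2 * k := rfl
      rw [this]
      simp
    | negSucc k =>
      have : Encodable.encode (Int.negSucc k) = 2 * k + 1 := rfl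
      rw [this]
      simp
  exact (Primrec.cond (Primrec.nat_bodd.comp Primrec.encode) (Primrec.const 0)
    (Primrec.nat_div2.comp Primrec.encode)).of_eq fun z => (h z).symm

theorem Primrec.int_toNat_neg : Primrec fun z : ℤ => (-z).toNat := by
  have h : ∀ z : ℤ, (-z).toNat =
      bif (Encodable.encode z).bodd then (Encodable.encode z).div2 + 1 else 0 := by
    intro z
    cases z with
    | ofNat k =>
      have : Encodable.encode (Int.ofNat k) = 2 * k := rfl
      rw [this]
      simp
    | negSucc k =>
      have : Encodable.encode (Int.negSucc k) = 2 * k + 1 := rfl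
      rw [this]
      simp
  exact (Primrec.cond (Primrec.nat_bodd.comp Primrec.encode)
    (Primrec.succ.comp (Primrec.nat_div2.comp Primrec.encode)) (Primrec.const 0)).of_eq
      fun z => (h z).symm

theorem Primrec.list_sum : Primrec (List.sum : List ℕ → ℕ) := by
  have h : Primrec₂ fun (_ : List ℕ) (p : ℕ × ℕ) => p.1 + p.2 :=
    (Primrec.nat_add.comp (Primrec.fst.comp Primrec.snd) (Primrec.snd.comp Primrec.snd)).to₂
  exact (Primrec.list_foldr Primrec.id (Primrec.const 0) h).of_eq fun l => by
    rw [List.sum_eq_foldr]; rfl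

theorem Primrec.two_pow : Primrec fun n : ℕ => 2 ^ n := by
  have h : Primrec₂ fun (_ : ℕ) (p : ℕ × ℕ) => 2 * p.2 :=
    (Primrec.nat_mul.comp (Primrec.const 2) (Primrec.snd.comp Primrec.snd)).to₂
  refine (Primrec.nat_rec' Primrec.id (Primrec.const 1) h).of_eq fun n => ?_
  induction n with
  | zero => rfl
  | succ n ih =>
    rw [pow_succ', ← ih]
    rfl

noncomputable section

/-! ### Linear relations modulo 1 in terms of binary digits. -/

namespace AlgSFT

/-- The integer whose binary digits are the first `N` terms of a sequence. -/
def trunc (β : ℕ → Bool) (N : ℕ) : ℕ :=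
  Nat.rec 0 (fun l acc => 2 * acc + bif β l then 1 else 0) N

/-- The real number in `[0, 1]` with the given binary digits. -/
def binReal (β : ℕ → Bool) : ℝ :=
  Real.ofDigits (b := 2) fun l => bif β l then 1 else 0

theorem trunc_succ (β : ℕ → Bool) (N : ℕ) :
    trunc β (N + 1) = 2 * trunc β N + bif β N then 1 else 0 := rfl

theorem trunc_congr {β β' : ℕ → Bool} {N : ℕ} (h : ∀ l < N, β l = β' l) :
    trunc β N = trunc β' N := by
  induction N with
  | zero => rfl
  | succ N ih => rw [trunc_succ, trunc_succ, ih fun l hl => h l (by omega), h N (by omega)]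

/-- Makes the natural subtraction in `discrepancy` exact. -/
theorem trunc_le (β : ℕ → Bool) (N : ℕ) : trunc β N ≤ 2 ^ N := by
  have : trunc β N < 2 ^ N := by
    induction N with
    | zero => exact Nat.one_pos
    | succ N ih =>
      rw [trunc_succ, pow_succ]
      cases β N <;> simp <;> omega
  exact this.le

theorem trunc_eq (β : ℕ → Bool) (N : ℕ) :
    (trunc β N : ℝ) = 2 ^ N * ∑ i ∈ Finset.range N,
      Real.ofDigitsTerm (b := 2) (fun l => bif β l then 1 else 0) i := by
  induction N with
  | zero => simp [trunc]
  | succ N ih =>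
    rw [trunc_succ, Finset.sum_range_succ, mul_add, pow_succ', mul_assoc, ← ih]
    push_cast
    congr 1
    rw [Real.ofDigitsTerm]
    cases β N
    · simp
    · simp [pow_succ]
      field_simp

theorem two_pow_mul_binReal (β : ℕ → Bool) (N : ℕ) :
    2 ^ N * binReal β = trunc β N + binReal fun l => β (l + N) := by
  rw [trunc_eq, binReal, Real.ofDigits_eq_sum_add_ofDigits _ N, mul_add, ← mul_assoc]
  congr 1
  simp [binReal]

theorem trunc_le_two_pow_mul_binReal (β : ℕ → Bool) (N : ℕ) :
    (trunc β N : ℝ) ≤ 2 ^ N * binReal β := by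
  rw [two_pow_mul_binReal]
  linarith [Real.ofDigits_nonneg (b := 2) fun l => bif β (l + N) then 1 else 0,
    show binReal (fun l => β (l + N)) = Real.ofDigits (b := 2) fun l => bif β (l + N) then 1 else 0
      from rfl]

theorem two_pow_mul_binReal_le (β : ℕ → Bool) (N : ℕ) :
    2 ^ N * binReal β ≤ trunc β N + 1 := by
  rw [two_pow_mul_binReal]
  linarith [Real.ofDigits_le_one (b := 2) fun l => bif β (l + N) then 1 else 0,
    show binReal (fun l => β (l + N)) = Real.ofDigits (b := 2) fun l => bif β (l + N) then 1 else 0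
      from rfl]

theorem continuous_binReal : Continuous binReal :=
  Real.continuous_ofDigits.comp (continuous_pi fun l =>
    (continuous_of_discreteTopology (f := fun b : Bool => (bif b then 1 else 0 : Fin 2))).comp
      (continuous_apply l))

theorem exists_binReal_eq (x : UnitAddCircle) : ∃ β, (binReal β : UnitAddCircle) = x := by
  obtain ⟨r, hr, rfl⟩ := AddCircle.coe_image_Ico_eq (1 : ℝ) 0 |>.ge (Set.mem_univ x)
  obtain ⟨d, -, hd⟩ := Real.ofDigits_SurjOn (b := 2) (by norm_num)
    (show r ∈ Set.Icc (0 : ℝ) 1 from ⟨hr.1, by linarith [hr.2]⟩)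
  refine ⟨fun l => d l == 1, ?_⟩
  rw [← hd, binReal]
  congr 3
  funext l
  generalize d l = e
  revert e
  decide

/-- An integer that differs from `2 ^ N ∑ (p - q) x`, up to a multiple of `2 ^ N`, by at most
`∑ (p + q)` from `∑ (p + q)`, the sums being over the entries `(p, q, x)` of a list. -/
def discrepancy (N : ℕ) (ts : List (ℕ × ℕ × (ℕ → Bool))) : ℕ :=
  (ts.map fun t => t.1 * trunc t.2.2 N + t.2.1 * (2 ^ N - trunc t.2.2 N) + (t.1 + t.2.1)).sum

/-- The sum of the coefficients `p + q`. -/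
def weight (ts : List (ℕ × ℕ × (ℕ → Bool))) : ℕ :=
  (ts.map fun t => t.1 + t.2.1).sum

/-- The real number `∑ (p - q) x`. -/
def realSum (ts : List (ℕ × ℕ × (ℕ → Bool))) : ℝ :=
  (ts.map fun t => ((t.1 : ℝ) - t.2.1) * binReal t.2.2).sum

/-- The sum of the coefficients `q`. -/
def negWeight (ts : List (ℕ × ℕ × (ℕ → Bool))) : ℕ :=
  (ts.map fun t => t.2.1).sum

/-- Replacing `-q x` by `q (1 - x)` keeps everything in ℕ and shifts the sum by the integer
`negWeight`. Truncation loses at most `p` below and gains at most `q` above, so the added `p + q`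
makes the error nonnegative and at most `2 (p + q)`. -/
theorem discrepancy_bounds (N : ℕ) (ts : List (ℕ × ℕ × (ℕ → Bool))) :
    2 ^ N * (realSum ts + negWeight ts) ≤ discrepancy N ts ∧
      (discrepancy N ts : ℝ) ≤ 2 ^ N * (realSum ts + negWeight ts) + 2 * weight ts := by
  induction ts with
  | nil => simp [discrepancy, weight, realSum, negWeight]
  | cons t ts ih =>
    obtain ⟨p, q, β⟩ := t
    simp only [discrepancy, weight, realSum, negWeight, List.map_cons, List.sum_cons] at ih ⊢
    push_cast [trunc_le β N] at ih ⊢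
    have h1 := trunc_le_two_pow_mul_binReal β N
    have h2 := two_pow_mul_binReal_le β N
    have hp1 := mul_le_mul_of_nonneg_left h1 (Nat.cast_nonneg (α := ℝ) p)
    have hp2 := mul_le_mul_of_nonneg_left h2 (Nat.cast_nonneg (α := ℝ) p)
    have hq1 := mul_le_mul_of_nonneg_left h1 (Nat.cast_nonneg (α := ℝ) q)
    have hq2 := mul_le_mul_of_nonneg_left h2 (Nat.cast_nonneg (α := ℝ) q)
    have hp : (0 : ℝ) ≤ p := Nat.cast_nonneg _
    have hq : (0 : ℝ) ≤ q := Nat.cast_nonneg _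
    constructor
    · linear_combination ih.1 + hp2 + hq1 + hq
    · linear_combination ih.2 + hp1 + hq2 + hp

/-- A linear relation between points of the circle, in terms of truncated binary expansions. -/
theorem realSum_coe_eq_zero_iff (ts : List (ℕ × ℕ × (ℕ → Bool))) :
    (realSum ts : UnitAddCircle) = 0 ↔ ∀ N, discrepancy N ts % 2 ^ N ≤ 2 * weight ts := by
  rw [AddCircle.coe_eq_zero_iff]
  constructor
  -- For an integer sum the discrepancy is a multiple of `2 ^ N` plus some `r` between 0 and `2 *
  -- weight ts`, and reduction modulo `2 ^ N` does not increase `r`.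
  · rintro ⟨k, hk⟩ N
    obtain ⟨h1, h2⟩ := discrepancy_bounds N ts
    rw [← hk, zsmul_one] at h1 h2
    have h1' : (2 : ℤ) ^ N * (k + negWeight ts) ≤ discrepancy N ts := by exact_mod_cast h1
    have h2' : (discrepancy N ts : ℤ) ≤ 2 ^ N * (k + negWeight ts) + 2 * weight ts := by
      exact_mod_cast h2
    obtain ⟨r, hr⟩ := Int.le.dest h1'
    have h3 : ((discrepancy N ts % 2 ^ N : ℕ) : ℤ) = ((r % 2 ^ N : ℕ) : ℤ) := by
      push_cast
      rw [← hr, Int.mul_add_emod_self_left]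
    have h4 : discrepancy N ts % 2 ^ N = r % 2 ^ N := by exact_mod_cast h3
    rw [h4]
    have h5 : r ≤ 2 * weight ts := by
      have : (r : ℤ) ≤ 2 * weight ts := by linarith
      exact_mod_cast this
    exact (Nat.mod_le _ _).trans h5
  · intro h
    set x := realSum ts + negWeight ts with hx
    -- A small residue at precision `N` puts `x` within `2 * weight ts / 2 ^ N` of an integer;
    -- letting `N` grow forces `x` to be one.
    have key : ∀ N : ℕ, |x - round x| ≤ 2 * weight ts * (1 / 2) ^ N := by
      intro N
      obtain ⟨h1, h2⟩ := discrepancy_bounds N ts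
      have h3 := h N
      have h4 : ((2 ^ N * (discrepancy N ts / 2 ^ N) + discrepancy N ts % 2 ^ N : ℕ) : ℝ) =
          discrepancy N ts := by rw [Nat.div_add_mod]
      have h5 : ((discrepancy N ts % 2 ^ N : ℕ) : ℝ) ≤ 2 * weight ts := by exact_mod_cast h3
      have h6 : (0 : ℝ) ≤ ((discrepancy N ts % 2 ^ N : ℕ) : ℝ) := Nat.cast_nonneg _
      refine (round_le x ((discrepancy N ts / 2 ^ N : ℕ) : ℤ)).trans ?_
      generalize discrepancy N ts / 2 ^ N = M at *
      generalize discrepancy N ts % 2 ^ N = ρ at *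
      have hpos : (0 : ℝ) < 2 ^ N := by positivity
      rw [one_div, inv_pow, ← div_eq_mul_inv, le_div_iff₀ hpos]
      nth_rewrite 1 [← abs_of_pos hpos]
      rw [← abs_mul, abs_le]
      push_cast at h4 ⊢
      constructor <;> nlinarith
    have hlim : Filter.Tendsto (fun N : ℕ => 2 * (weight ts : ℝ) * (1 / 2) ^ N) Filter.atTop
        (nhds 0) := by
      simpa using (tendsto_pow_atTop_nhds_zero_of_lt_one (r := (1 / 2 : ℝ)) (by norm_num)
        (by norm_num)).const_mul (2 * (weight ts : ℝ))
    have h0 : |x - round x| ≤ 0 := ge_of_tendsto' hlim key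
    have h1 : x = round x := sub_eq_zero.1 (abs_nonpos_iff.1 h0)
    refine ⟨round x - negWeight ts, ?_⟩
    rw [zsmul_one]
    push_cast
    rw [← h1, hx]
    ring

theorem realSum_coe (ts : List (ℕ × ℕ × (ℕ → Bool))) :
    (realSum ts : UnitAddCircle) =
      (ts.map fun t => ((t.1 : ℤ) - t.2.1) • (binReal t.2.2 : UnitAddCircle)).sum := by
  induction ts with
  | nil => simp [realSum]
  | cons t ts ih =>
    rw [List.map_cons, List.sum_cons, ← ih, ← AddCircle.coe_zsmul, ← AddCircle.coe_add]
    congr 1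
    simp [realSum]

end AlgSFT
end

noncomputable section

namespace AlgSFT

/-! ### Numbering of group elements by words. -/

section Numbering

/-- The word with a given code. -/
def wordOf (m a : ℕ) : List (Fin m) :=
  (Encodable.decode a).getD []

/-- The code of a concatenation. -/
def mulCode (m a b : ℕ) : ℕ :=
  Encodable.encode (wordOf m a ++ wordOf m b)

theorem wordOf_encode {m : ℕ} (w : List (Fin m)) : wordOf m (Encodable.encode w) = w := by
  simp [wordOf]

theorem primrec_wordOf (m : ℕ) : Primrec (wordOf m) :=
  Primrec.option_getD.comp Primrec.decode (Primrec.const [])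

theorem primrec_mulCode (m : ℕ) : Primrec₂ (mulCode m) :=
  Primrec.encode.comp (Primrec.list_append.comp ((primrec_wordOf m).comp Primrec.fst)
    ((primrec_wordOf m).comp Primrec.snd))

variable {Γ : Type*} [Group Γ] {m : ℕ} (s : Fin m → Γ)

theorem evalWord_append (u v : List (Fin m)) :
    evalWord s (u ++ v) = evalWord s u * evalWord s v := by
  simp [evalWord]

/-- The group element with a given code. -/
def num (a : ℕ) : Γ :=
  evalWord s (wordOf m a)

theorem num_encode (w : List (Fin m)) : num s (Encodable.encode w) = evalWord s w := by
  rw [num, wordOf_encode]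

theorem num_mulCode (a b : ℕ) : num s (mulCode m a b) = num s a * num s b := by
  rw [mulCode, num_encode, evalWord_append, num, num]

theorem Generates.exists_num_eq {s : Fin m → Γ} (hs : Generates s) (g : Γ) : ∃ a, num s a = g := by
  obtain ⟨w, rfl⟩ := hs g
  exact ⟨_, num_encode s w⟩

theorem evalWord_flatMap {m' : ℕ} {s' : Fin m' → Γ} {t : Fin m → List (Fin m')}
    (ht : ∀ i, evalWord s' (t i) = s i) (w : List (Fin m)) :
    evalWord s' (w.flatMap t) = evalWord s w := by
  induction w with
  | nil => rfl
  | cons i w ih =>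
    rw [List.flatMap_cons, evalWord_append, ht, ih]
    simp [evalWord]

theorem evalWord_reverse_flatMap {m' : ℕ} {s' : Fin m' → Γ} {r : Fin m → List (Fin m')}
    (hr : ∀ i, evalWord s' (r i) = (s i)⁻¹) (w : List (Fin m)) :
    evalWord s' (w.reverse.flatMap r) = (evalWord s w)⁻¹ := by
  induction w with
  | nil => simp [evalWord]
  | cons i w ih =>
    rw [List.reverse_cons, List.flatMap_append, evalWord_append, ih]
    simp [evalWord, List.flatMap_cons] at hr ⊢
    rw [hr]

/-- In a recursively presented group, equality of words over any finite family is recursively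
enumerable. -/
theorem IsRecursivelyPresentedGroup.rePred_num_eq (h : IsRecursivelyPresentedGroup Γ) :
    REPred fun p : ℕ × ℕ => num s p.1 = num s p.2 := by
  obtain ⟨m', s', hs', hre⟩ := h
  -- Words are rewritten letter by letter into the family whose word problem is enumerable, and `u =
  -- v` becomes `u v⁻¹ = 1`. The substitutions `t` and `r` have finite domain, so choosing them
  -- costs no computability.
  choose t ht using fun i => hs' (s i)
  choose r hr using fun i => hs' (s i)⁻¹
  have hc : Primrec fun p : ℕ × ℕ =>
      (wordOf m p.1).flatMap t ++ (wordOf m p.2).reverse.flatMap r := by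
    refine Primrec.list_append.comp ?_ ?_
    · exact Primrec.list_flatMap ((primrec_wordOf m).comp Primrec.fst)
        ((Primrec.dom_finite t).comp Primrec.snd).to₂
    · exact Primrec.list_flatMap
        (Primrec.list_reverse.comp ((primrec_wordOf m).comp Primrec.snd))
        ((Primrec.dom_finite r).comp Primrec.snd).to₂
  refine (hre.comp_computable hc.to_comp).of_eq fun p => ?_
  rw [evalWord_append, evalWord_flatMap s ht, evalWord_reverse_flatMap s hr, mul_inv_eq_one]
  rfl

end Numbering

section Prefixes

theorem mem_cyl_iff {w : List Bool} {x : ℕ → Bool} :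
    x ∈ cyl w ↔ ∀ j < w.length, w.getD j false = x j := by
  constructor
  · intro h j hj
    rw [List.getD_eq_getElem _ _ hj]
    exact (h ⟨j, hj⟩).symm
  · rintro h ⟨j, hj⟩
    have := h j hj
    rw [List.getD_eq_getElem _ _ hj] at this
    exact this.symm

theorem exists_mem_cyl (x : ℕ → Bool) (M : ℕ) : ∃ w : List Bool, w.length = M ∧ x ∈ cyl w :=
  ⟨(List.range M).map x, by simp, fun i => by simp⟩

end Prefixes

/-! ### Finite prefixes that witness a failure. -/

section Equations

/-- The terms of an equation at the group element with code `a`. An entry `(i, w, p, q)` of an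
equation stands for the term `p - q` times the translate of the `i`-th coordinate by the group
element with code `w`. -/
def entries (m a : ℕ) (y : ℕ → Bool) (E : List (ℕ × ℕ × ℕ × ℕ)) :
    List (ℕ × ℕ × (ℕ → Bool)) :=
  E.map fun e => (e.2.2.1, e.2.2.2, fun l => y (Nat.pair (mulCode m a e.2.1) (Nat.pair e.1 l)))

/-- A bound for the positions of the digits involved in an equation at precision `N`. -/
def useBound (m a N : ℕ) (E : List (ℕ × ℕ × ℕ × ℕ)) : ℕ :=
  (E.map fun e => Nat.pair (mulCode m a e.2.1) (Nat.pair e.1 N)).sum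

/-- Precision `N` reads only digits `l < N`; pairing is increasing, and the sum defining `useBound`
dominates each of its terms. -/
theorem discrepancy_entries_congr {m a N : ℕ} {E : List (ℕ × ℕ × ℕ × ℕ)} {y y' : ℕ → Bool}
    (h : ∀ j < useBound m a N E, y j = y' j) :
    discrepancy N (entries m a y E) = discrepancy N (entries m a y' E) := by
  rw [discrepancy, discrepancy, entries, entries, List.map_map, List.map_map]
  congr 1
  refine List.map_congr_left fun e he => ?_
  have : trunc (fun l => y (Nat.pair (mulCode m a e.2.1) (Nat.pair e.1 l))) N =
      trunc (fun l => y' (Nat.pair (mulCode m a e.2.1) (Nat.pair e.1 l))) N := by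
    refine trunc_congr fun l hl => h _ ?_
    refine (Nat.pair_lt_pair_right _ (Nat.pair_lt_pair_right _ hl)).trans_le ?_
    exact List.single_le_sum (fun _ _ => Nat.zero_le _) _
      (List.mem_map.2 ⟨e, he, rfl⟩)
  simp only [Function.comp_apply, this]

theorem weight_entries (m a : ℕ) (y : ℕ → Bool) (E : List (ℕ × ℕ × ℕ × ℕ)) :
    weight (entries m a y E) = (E.map fun e => e.2.2.1 + e.2.2.2).sum := by
  rw [weight, entries, List.map_map]
  rfl

theorem primrec_trunc {α : Type*} [Primcodable α] {β : α → ℕ → Bool} {N : α → ℕ}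
    (hβ : Primrec₂ β) (hN : Primrec N) : Primrec fun x => trunc (β x) (N x) := by
  have hstep : Primrec₂ fun (x : α) (r : ℕ × ℕ) => 2 * r.2 + bif β x r.1 then 1 else 0 :=
    Primrec.nat_add.comp
      (Primrec.nat_mul.comp (Primrec.const 2) (Primrec.snd.comp Primrec.snd))
      (Primrec.cond (hβ.comp Primrec.fst (Primrec.fst.comp Primrec.snd)) (Primrec.const 1)
        (Primrec.const 0))
  exact Primrec.nat_rec' hN (Primrec.const 0) hstep

open Primrec in
theorem primrec_discrepancy (m : ℕ) :
    Primrec fun x : (List (ℕ × ℕ × ℕ × ℕ) × ℕ × ℕ) × List Bool =>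
      discrepancy x.1.2.2 (entries m x.1.2.1 (fun j => x.2.getD j false) x.1.1) := by
  let Q := (List (ℕ × ℕ × ℕ × ℕ) × ℕ × ℕ) × List Bool
  have hidx : Primrec fun z : (Q × (ℕ × ℕ × ℕ × ℕ)) × ℕ =>
      Nat.pair (mulCode m z.1.1.1.2.1 z.1.2.2.1) (Nat.pair z.1.2.1 z.2) :=
    Primrec₂.natPair.comp
      ((primrec_mulCode m).comp (fst.comp (snd.comp (fst.comp (fst.comp fst))))
        (fst.comp (snd.comp (snd.comp fst))))
      (Primrec₂.natPair.comp (fst.comp (snd.comp fst)) snd)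
  have hbit : Primrec fun z : (Q × (ℕ × ℕ × ℕ × ℕ)) × ℕ =>
      z.1.1.2.getD (Nat.pair (mulCode m z.1.1.1.2.1 z.1.2.2.1) (Nat.pair z.1.2.1 z.2)) false :=
    (list_getD false).comp (snd.comp (fst.comp fst)) hidx
  have hT : Primrec fun z : Q × (ℕ × ℕ × ℕ × ℕ) =>
      trunc (fun l => z.1.2.getD (Nat.pair (mulCode m z.1.1.2.1 z.2.2.1) (Nat.pair z.2.1 l)) false)
        z.1.1.2.2 := by
    exact primrec_trunc (β := fun (z : Q × (ℕ × ℕ × ℕ × ℕ)) l =>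
      z.1.2.getD (Nat.pair (mulCode m z.1.1.2.1 z.2.2.1) (Nat.pair z.2.1 l)) false)
      hbit.to₂ (snd.comp (snd.comp (fst.comp fst)))
  have hp : Primrec fun z : Q × (ℕ × ℕ × ℕ × ℕ) => z.2.2.2.1 :=
    fst.comp (snd.comp (snd.comp snd))
  have hq : Primrec fun z : Q × (ℕ × ℕ × ℕ × ℕ) => z.2.2.2.2 :=
    snd.comp (snd.comp (snd.comp snd))
  have hN : Primrec fun z : Q × (ℕ × ℕ × ℕ × ℕ) => 2 ^ z.1.1.2.2 :=
    two_pow.comp (snd.comp (snd.comp (fst.comp fst)))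
  have hterm := nat_add.comp (nat_add.comp (nat_mul.comp hp hT)
    (nat_mul.comp hq (nat_sub.comp hN hT))) (nat_add.comp hp hq)
  refine (list_sum.comp (list_map (fst.comp fst) hterm.to₂)).of_eq fun x => ?_
  rw [discrepancy, entries, List.map_map]
  rfl

open Primrec in
theorem primrec_useBound (m : ℕ) :
    Primrec fun x : List (ℕ × ℕ × ℕ × ℕ) × ℕ × ℕ => useBound m x.2.1 x.2.2 x.1 := by
  have h : Primrec fun z : (List (ℕ × ℕ × ℕ × ℕ) × ℕ × ℕ) × (ℕ × ℕ × ℕ × ℕ) =>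
      Nat.pair (mulCode m z.1.2.1 z.2.2.1) (Nat.pair z.2.1 z.1.2.2) :=
    Primrec₂.natPair.comp
      ((primrec_mulCode m).comp (fst.comp (snd.comp fst)) (fst.comp (snd.comp snd)))
      (Primrec₂.natPair.comp (fst.comp snd) (snd.comp (snd.comp fst)))
  exact list_sum.comp (list_map fst h.to₂)

open Primrec in
theorem primrec_weight :
    Primrec fun E : List (ℕ × ℕ × ℕ × ℕ) => (E.map fun e => e.2.2.1 + e.2.2.2).sum :=
  list_sum.comp (list_map Primrec.id (nat_add.comp (fst.comp (snd.comp (snd.comp snd)))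
    (snd.comp (snd.comp (snd.comp snd)))).to₂)

/-- A prefix that witnesses the failure of an equation at a given precision. -/
def Violates (m : ℕ) (x : (List (ℕ × ℕ × ℕ × ℕ) × ℕ × ℕ) × List Bool) : Prop :=
  useBound m x.1.2.1 x.1.2.2 x.1.1 ≤ x.2.length ∧
    2 * (x.1.1.map fun e => e.2.2.1 + e.2.2.2).sum <
      discrepancy x.1.2.2 (entries m x.1.2.1 (fun j => x.2.getD j false) x.1.1) % 2 ^ x.1.2.2

open Primrec in
theorem primrecPred_violates (m : ℕ) : PrimrecPred (Violates m) := by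
  refine PrimrecPred.and ?_ ?_
  · exact nat_le.comp ((primrec_useBound m).comp fst) (list_length.comp snd)
  · exact nat_lt.comp (nat_mul.comp (const 2) (primrec_weight.comp (fst.comp fst)))
      (nat_mod.comp (primrec_discrepancy m) (two_pow.comp (snd.comp (snd.comp fst))))

/-- Failure shows at some precision, which reads a bounded part of `y`. The length condition in
`Violates` ensures that the default bit of `getD` is never used. -/
theorem exists_violates_iff {m : ℕ} {E : List (ℕ × ℕ × ℕ × ℕ)} {a : ℕ} {y : ℕ → Bool} :
    (realSum (entries m a y E) : UnitAddCircle) ≠ 0 ↔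
      ∃ N v, Violates m ((E, a, N), v) ∧ y ∈ cyl v := by
  rw [Ne, realSum_coe_eq_zero_iff]
  push Not
  refine exists_congr fun N => ?_
  rw [weight_entries]
  constructor
  · intro h
    obtain ⟨v, hv, hy⟩ := exists_mem_cyl y (useBound m a N E)
    refine ⟨v, ⟨hv.ge, ?_⟩, hy⟩
    dsimp only
    rw [discrepancy_entries_congr (y' := y) fun j hj => mem_cyl_iff.1 hy j (hj.trans_eq hv.symm)]
    exact h
  · rintro ⟨v, ⟨hb, hv⟩, hy⟩
    dsimp only at hb hv
    rw [discrepancy_entries_congr (y' := y) fun j hj =>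
      mem_cyl_iff.1 hy j (hj.trans_le hb)] at hv
    exact hv

/-- A prefix that takes different values at two positions. -/
def Differs (x : (ℕ × ℕ × ℕ) × List Bool) : Prop :=
  Nat.pair x.1.1 x.1.2.2 < x.2.length ∧ Nat.pair x.1.2.1 x.1.2.2 < x.2.length ∧
    x.2.getD (Nat.pair x.1.1 x.1.2.2) false ≠ x.2.getD (Nat.pair x.1.2.1 x.1.2.2) false

open Primrec in
theorem primrecPred_differs : PrimrecPred Differs := by
  have h1 : Primrec fun x : (ℕ × ℕ × ℕ) × List Bool => Nat.pair x.1.1 x.1.2.2 :=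
    Primrec₂.natPair.comp (fst.comp fst) (snd.comp (snd.comp fst))
  have h2 : Primrec fun x : (ℕ × ℕ × ℕ) × List Bool => Nat.pair x.1.2.1 x.1.2.2 :=
    Primrec₂.natPair.comp (fst.comp (snd.comp fst)) (snd.comp (snd.comp fst))
  exact (nat_lt.comp h1 (list_length.comp snd)).and ((nat_lt.comp h2 (list_length.comp snd)).and
    (Primrec.eq.comp ((list_getD false).comp snd h1) ((list_getD false).comp snd h2)).not)

theorem exists_differs_iff {a a' b : ℕ} {y : ℕ → Bool} :
    y (Nat.pair a b) ≠ y (Nat.pair a' b) ↔ ∃ v, Differs ((a, a', b), v) ∧ y ∈ cyl v := by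
  constructor
  · intro h
    obtain ⟨v, hv, hy⟩ := exists_mem_cyl y (Nat.pair a b + Nat.pair a' b + 1)
    have h1 : Nat.pair a b < v.length := by omega
    have h2 : Nat.pair a' b < v.length := by omega
    refine ⟨v, ⟨h1, h2, ?_⟩, hy⟩
    dsimp only
    rwa [mem_cyl_iff.1 hy _ h1, mem_cyl_iff.1 hy _ h2]
  · rintro ⟨v, ⟨h1, h2, h⟩, hy⟩
    dsimp only at h1 h2 h
    rwa [mem_cyl_iff.1 hy _ h1, mem_cyl_iff.1 hy _ h2] at h

end Equations

/-! ### The effectively closed set of codes and its computable action. -/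

section Codes

variable {Γ : Type*} [Group Γ] {m : ℕ} (s : Fin m → Γ) (E : ℕ → List (ℕ × ℕ × ℕ × ℕ))

/-- The binary sequences that encode the solutions of a sequence of equations: the digits of the
value of the `i`-th coordinate at the group element with code `a` are stored at the positions
`⟨a, ⟨i, l⟩⟩`. -/
def codes : Set (ℕ → Bool) :=
  {y | (∀ a a' b, num s a = num s a' → y (Nat.pair a b) = y (Nat.pair a' b)) ∧
    ∀ k a, (realSum (entries m a y (E k)) : UnitAddCircle) = 0}

/-- Inconsistency is found by enumerating an equality of words together with a prefix on which the
digits differ; only the enumerable half of the word problem is needed. -/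
theorem isEffectivelyClosed_codes (hΓ : IsRecursivelyPresentedGroup Γ) (hE : Computable E) :
    IsEffectivelyClosed (codes s E) := by
  refine ⟨fun v => (∃ x : ℕ × ℕ × ℕ, num s x.1 = num s x.2.1 ∧ Differs (x, v)) ∨
    ∃ x : ℕ × ℕ × ℕ, Violates m ((E x.1, x.2), v), ?_, ?_⟩
  · refine REPred.or ?_ ?_
    · refine REPred.exists (p := fun z : List Bool × (ℕ × ℕ × ℕ) =>
        num s z.2.1 = num s z.2.2.1 ∧ Differs (z.2, z.1)) ?_
      refine REPred.and ?_ ?_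
      · exact (hΓ.rePred_num_eq s).comp_computable (f := fun z : List Bool × (ℕ × ℕ × ℕ) =>
          (z.2.1, z.2.2.1)) ((Primrec.fst.comp Primrec.snd).pair
            (Primrec.fst.comp (Primrec.snd.comp Primrec.snd))).to_comp
      · exact (primrecPred_differs.comp (Primrec.snd.pair Primrec.fst)).computablePred.to_re
    · refine REPred.exists (p := fun z : List Bool × (ℕ × ℕ × ℕ) =>
        Violates m ((E z.2.1, z.2.2), z.1)) ?_
      exact (primrecPred_violates m).computablePred.to_re.comp_computable
        (f := fun z : List Bool × (ℕ × ℕ × ℕ) => ((E z.2.1, z.2.2), z.1))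
        (((hE.comp (Computable.fst.comp Computable.snd)).pair
          (Computable.snd.comp Computable.snd)).pair Computable.fst)
  · ext y
    simp only [Set.mem_compl_iff, Set.mem_iUnion, Set.mem_setOf_eq, exists_prop]
    constructor
    · intro hy
      by_cases h : ∀ a a' b, num s a = num s a' → y (Nat.pair a b) = y (Nat.pair a' b)
      · have h2 : ¬ ∀ k a, (realSum (entries m a y (E k)) : UnitAddCircle) = 0 := fun h2 =>
          hy ⟨h, h2⟩
        push Not at h2
        obtain ⟨k, a, h2⟩ := h2
        obtain ⟨N, v, hv, hyv⟩ := exists_violates_iff.1 h2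
        exact ⟨v, .inr ⟨(k, a, N), hv⟩, hyv⟩
      · push Not at h
        obtain ⟨a, a', b, h1, h2⟩ := h
        obtain ⟨v, hv, hyv⟩ := exists_differs_iff.1 h2
        exact ⟨v, .inl ⟨(a, a', b), h1, hv⟩, hyv⟩
    · rintro ⟨v, ⟨⟨a, a', b⟩, h1, hv⟩ | ⟨⟨k, a, N⟩, hv⟩, hyv⟩ hy
      · exact exists_differs_iff.2 ⟨v, hv, hyv⟩ (hy.1 a a' b h1)
      · exact exists_violates_iff.2 ⟨N, v, hv, hyv⟩ (hy.2 k a)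

/-- Left multiplication of positions by the group element with code `u`. -/
def movePos (m u j : ℕ) : ℕ :=
  Nat.pair (mulCode m u j.unpair.1) j.unpair.2

theorem movePos_pair (m u a b : ℕ) :
    movePos m u (Nat.pair a b) = Nat.pair (mulCode m u a) b := by
  simp [movePos]

theorem primrec_movePos (m u : ℕ) : Primrec (movePos m u) :=
  Primrec₂.natPair.comp ((primrec_mulCode m).comp (Primrec.const u)
    (Primrec.fst.comp Primrec.unpair)) (Primrec.snd.comp Primrec.unpair)

variable {s E}

theorem codes_apply_eq {y : ℕ → Bool} (hy : y ∈ codes s E) {a a' : ℕ} (h : num s a = num s a')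
    (b : ℕ) : y (Nat.pair a b) = y (Nat.pair a' b) :=
  hy.1 a a' b h

/-- Equations translate indices on the right and `movePos` on the left, so the two commute up to
words naming the same element, where `y` agrees. -/
theorem comp_movePos_mem_codes {y : ℕ → Bool} (hy : y ∈ codes s E) (u : ℕ) :
    y ∘ movePos m u ∈ codes s E := by
  refine ⟨fun a a' b h => ?_, fun k a => ?_⟩
  · simp only [Function.comp_apply, movePos_pair]
    exact codes_apply_eq hy (by rw [num_mulCode, num_mulCode, h]) b
  · have : entries m a (y ∘ movePos m u) (E k) = entries m (mulCode m u a) y (E k) := by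
      refine List.map_congr_left fun e _ => ?_
      simp only [Function.comp_apply, movePos_pair]
      congr 2
      funext l
      exact codes_apply_eq hy (by simp only [num_mulCode, mul_assoc]) _
    rw [this]
    exact hy.2 k _

/-- The shift action on codes. -/
@[reducible]
def codesAction (hs : Generates s) : MulAction Γ (codes s E) where
  -- The word for `g⁻¹` is arbitrary: consistency of `y` makes the result independent of it, which
  -- also yields the action laws.
  smul g y := ⟨y.1 ∘ movePos m (hs.exists_num_eq g⁻¹).choose, comp_movePos_mem_codes y.2 _⟩
  one_smul y := by
    apply Subtype.ext
    funext j
    change y.1 (movePos m _ j) = y.1 j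
    conv_rhs => rw [← Nat.pair_unpair j]
    refine codes_apply_eq y.2 ?_ _
    rw [num_mulCode, (hs.exists_num_eq 1⁻¹).choose_spec, inv_one, one_mul]
  mul_smul g h y := by
    apply Subtype.ext
    funext j
    change y.1 (movePos m _ j) = y.1 (movePos m _ (movePos m _ j))
    rw [movePos, movePos, movePos, Nat.unpair_pair]
    refine codes_apply_eq y.2 ?_ _
    simp only [num_mulCode]
    rw [(hs.exists_num_eq (g * h)⁻¹).choose_spec, (hs.exists_num_eq g⁻¹).choose_spec,
      (hs.exists_num_eq h⁻¹).choose_spec, mul_inv_rev, mul_assoc]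

theorem isComputableMap_comp {X : Set (ℕ → Bool)} {τ : ℕ → ℕ} (hτ : Primrec τ) :
    IsComputableMap fun x : X => x.1 ∘ τ := by
  -- Comparing options requires the prefix `z.2` to be long enough to determine every bit prescribed
  -- by `z.1`.
  refine ⟨fun z => (List.range z.1.length).map (fun j => z.2[τ j]?) = z.1.map some, ?_, ?_⟩
  · have h : PrimrecPred fun z : List Bool × List Bool =>
        (List.range z.1.length).map (fun j => z.2[τ j]?) = z.1.map some := by
      refine Primrec.eq.comp ?_ ?_
      · exact Primrec.list_map (Primrec.list_range.comp (Primrec.list_length.comp Primrec.fst))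
          (Primrec.list_getElem?.comp (Primrec.snd.comp Primrec.fst) (hτ.comp Primrec.snd)).to₂
      · exact Primrec.list_map Primrec.fst (Primrec.option_some.comp Primrec.snd).to₂
    exact h.computablePred.to_re
  · intro w
    ext x
    simp only [Set.mem_preimage, Set.mem_iUnion, Set.mem_setOf_eq, exists_prop]
    constructor
    · intro hx
      obtain ⟨v, hv, hxv⟩ := exists_mem_cyl x.1 (((List.range w.length).map τ).sum + 1)
      refine ⟨v, ?_, hxv⟩
      refine List.ext_getElem (by simp) fun j h1 h2 => ?_
      have hj : j < w.length := by simpa using h2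
      have hle : τ j ≤ ((List.range w.length).map τ).sum :=
        List.single_le_sum (fun _ _ => Nat.zero_le _) _
          (List.mem_map.2 ⟨j, List.mem_range.2 hj, rfl⟩)
      have hjv : τ j < v.length := by omega
      have e1 := mem_cyl_iff.1 hxv _ hjv
      have e2 := mem_cyl_iff.1 hx _ hj
      rw [List.getD_eq_getElem _ _ hjv] at e1
      rw [List.getD_eq_getElem _ _ hj] at e2
      simp only [List.getElem_map, List.getElem_range, List.getElem?_eq_getElem hjv, e1, e2]
      rfl
    · rintro ⟨v, hv, hxv⟩
      rw [mem_cyl_iff]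
      intro j hj
      have h := congrArg (fun l => l[j]?) hv
      simp only [List.getElem?_map, List.getElem?_range hj, List.getElem?_eq_getElem hj,
        Option.map_some, Option.some.injEq] at h
      obtain ⟨hjv, h⟩ := List.getElem?_eq_some_iff.1 h
      have e1 := mem_cyl_iff.1 hxv _ hjv
      rw [List.getD_eq_getElem _ _ hjv] at e1
      rw [List.getD_eq_getElem _ _ hj, ← h, e1]
      rfl

/-- Each generator uses one fixed word for its inverse, so no uniform choice of words has to be
computed. -/
theorem isComputableAction_codes (hs : Generates s) :
    @IsComputableAction Γ _ (codes s E) (codesAction hs) :=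
  letI := codesAction (E := E) hs
  ⟨m, s, hs, fun i => isComputableMap_comp (primrec_movePos m _)⟩

end Codes

end AlgSFT
end

noncomputable section

namespace AlgSFT

variable {Γ : Type*} [Group Γ]

/-! ### Equations over the group ring as lists of entries. -/

section Monomials

variable {m n : ℕ}

theorem mulStar_evalRing_ofMonomials (s : Fin m → Γ) (x : Γ → UnitAddCircle)
    (l : List (List (Fin m) × ℤ)) (h : Γ) :
    mulStar x (evalRing s (ofMonomials l)) h =
      (l.map fun t => t.2 • x (h * evalWord s t.1)).sum := by
  induction l with
  | nil =>
    have : evalRing s (ofMonomials []) = 0 := by simp [ofMonomials, evalRing]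
    simp [this, mulStar_zero]
  | cons t l ih =>
    have : evalRing s (ofMonomials [t]) = MonoidAlgebra.single (evalWord s t.1) t.2 := by
      simp [ofMonomials, evalRing, Finsupp.sum_single_index]
    rw [← List.singleton_append, ofMonomials_append, evalRing_add, mulStar_add, Pi.add_apply, ih,
      this, mulStar_single]
    simp

/-- The entries of an equation given by lists of monomials. -/
def equationEntries (c : Fin n → List (List (Fin m) × ℤ)) : List (ℕ × ℕ × ℕ × ℕ) :=
  -- An integer coefficient is split into its positive and negative parts.
  (List.ofFn fun i => (c i).map fun t =>
    ((i : ℕ), Encodable.encode t.1, t.2.toNat, (-t.2).toNat)).flatten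

theorem primrec_equationEntries : Primrec (equationEntries (m := m) (n := n)) := by
  refine Primrec.list_flatten.comp (Primrec.list_ofFn fun i => ?_)
  refine Primrec.list_map (Primrec.fin_app.comp Primrec.id (Primrec.const i)) ?_
  have ht : Primrec fun x : (Fin n → List (List (Fin m) × ℤ)) × (List (Fin m) × ℤ) => x.2.2 :=
    Primrec.snd.comp Primrec.snd
  exact ((Primrec.const (i : ℕ)).pair ((Primrec.encode.comp (Primrec.fst.comp Primrec.snd)).pair
    ((Primrec.int_toNat.comp ht).pair (Primrec.int_toNat_neg.comp ht)))).to₂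

theorem realSum_entries_equationEntries {s : Fin m → Γ} {y : ℕ → Bool}
    {x : Fin n → Γ → UnitAddCircle}
    (hx : ∀ a (i : Fin n),
      (binReal fun l => y (Nat.pair a (Nat.pair i l)) : UnitAddCircle) = x i (num s a))
    (c : Fin n → List (List (Fin m) × ℤ)) (a : ℕ) :
    (realSum (entries m a y (equationEntries c)) : UnitAddCircle) =
      ∑ i, mulStar (x i) (evalRing s (ofMonomials (c i))) (num s a) := by
  rw [realSum_coe, entries, equationEntries, List.map_map, List.map_flatten, List.sum_flatten,
    List.map_map, List.map_ofFn, List.sum_ofFn]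
  refine Finset.sum_congr rfl fun i _ => ?_
  rw [mulStar_evalRing_ofMonomials]
  simp only [Function.comp_apply, List.map_map]
  congr 1
  refine List.map_congr_left fun t _ => ?_
  simp only [Function.comp_apply, hx, num_mulCode, num_encode]
  rw [Int.toNat_sub_toNat_neg]

end Monomials

/-! ### Decoding binary sequences into solutions. -/

section Decoding

variable {m n : ℕ} {s : Fin m → Γ} {E : ℕ → List (ℕ × ℕ × ℕ × ℕ)}

/-- The point of `((ℝ/ℤ)^Γ)ⁿ` encoded by a binary sequence. -/
def decodePoint (hs : Generates s) (n : ℕ) (y : ℕ → Bool) : Fin n → Γ → UnitAddCircle :=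
  fun i h => (binReal fun l => y (Nat.pair (hs.exists_num_eq h).choose (Nat.pair i l)) :)

theorem continuous_decodePoint (hs : Generates s) : Continuous (decodePoint hs n) :=
  continuous_pi fun i => continuous_pi fun h => (AddCircle.continuous_mk' 1).comp
    (continuous_binReal.comp (continuous_pi fun l => continuous_apply _))

/-- On a code, any word for a group element may replace the one chosen in `decodePoint`. -/
theorem decodePoint_num (hs : Generates s) {y : ℕ → Bool} (hy : y ∈ codes s E) (a : ℕ)
    (i : Fin n) :
    (binReal fun l => y (Nat.pair a (Nat.pair i l)) : UnitAddCircle) =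
      decodePoint hs n y i (num s a) := by
  rw [decodePoint]
  congr 2
  funext l
  exact codes_apply_eq hy (hs.exists_num_eq (num s a)).choose_spec.symm _

theorem decodePoint_comp_movePos (hs : Generates s) {y : ℕ → Bool} (hy : y ∈ codes s E) (u : ℕ)
    (i : Fin n) (h : Γ) :
    decodePoint hs n (y ∘ movePos m u) i h = decodePoint hs n y i (num s u * h) := by
  obtain ⟨a, rfl⟩ := hs.exists_num_eq h
  rw [← decodePoint_num hs (comp_movePos_mem_codes hy u), ← num_mulCode, ← decodePoint_num hs hy]
  simp only [Function.comp_apply, movePos_pair]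

theorem decodePoint_mem_solutions (hs : Generates s) {c : ℕ → Fin n → List (List (Fin m) × ℤ)}
    {y : ℕ → Bool} (hy : y ∈ codes s fun k => equationEntries (c k)) :
    decodePoint hs n y ∈ solutions fun k i => evalRing s (ofMonomials (c k i)) := by
  intro k
  funext h
  obtain ⟨a, rfl⟩ := hs.exists_num_eq h
  rw [Finset.sum_apply, ← realSum_entries_equationEntries (decodePoint_num hs hy)]
  exact hy.2 k a

theorem exists_decodePoint_eq (hs : Generates s) {c : ℕ → Fin n → List (List (Fin m) × ℤ)}
    {x : Fin n → Γ → UnitAddCircle}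
    (hx : x ∈ solutions fun k i => evalRing s (ofMonomials (c k i))) :
    ∃ y ∈ codes s fun k => equationEntries (c k), decodePoint hs n y = x := by
  -- One expansion is fixed per point of the circle, so words naming the same element receive the
  -- same digits. Positions whose coordinate index is not below `n` are unused and set to `false`.
  choose β hβ using exists_binReal_eq
  let y : ℕ → Bool := fun j =>
    if hi : j.unpair.2.unpair.1 < n then
      β (x ⟨_, hi⟩ (num s j.unpair.1)) j.unpair.2.unpair.2 else false
  have hyx : ∀ a (i : Fin n),
      (binReal fun l => y (Nat.pair a (Nat.pair i l)) : UnitAddCircle) = x i (num s a) := by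
    intro a i
    rw [← hβ (x i (num s a))]
    congr 2
    funext l
    simp [y]
  have hy : y ∈ codes s fun k => equationEntries (c k) := by
    refine ⟨fun a a' b h => by simp only [y, Nat.unpair_pair, h], fun k a => ?_⟩
    rw [realSum_entries_equationEntries hyx, ← Finset.sum_apply]
    exact congrFun (hx k) _
  refine ⟨y, hy, ?_⟩
  funext i h
  obtain ⟨a, rfl⟩ := hs.exists_num_eq h
  rw [← decodePoint_num hs hy, hyx]

end Decoding

/-- Over a recursively presented self-simulable group, recursively presented algebraic actions are
topological factors of subshifts of finite type. -/
theorem IsRecursivelyPresentedAction.isFactorOfSFT (hrec : IsRecursivelyPresentedGroup Γ)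
    (hsim : IsSelfSimulable Γ) {X : Type*} [AddCommGroup X] [TopologicalSpace X]
    [DistribMulAction Γ X] [ContinuousConstSMul Γ X] (h : IsRecursivelyPresentedAction Γ X) :
    IsFactorOfSFT Γ X := by
  obtain ⟨-, m, s, n, g, hs, ⟨c, hc, hg⟩, e, he⟩ := h
  obtain rfl : g = fun k i => ofMonomials (c k i) := by
    funext k i
    exact hg k i
  let Z := codes s fun k => equationEntries (c k)
  obtain ⟨a, Y, hY, f, hf, hfs, hfe⟩ := hsim Z
    (isEffectivelyClosed_codes s _ hrec (primrec_equationEntries.to_comp.comp hc))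
    (codesAction hs) (isComputableAction_codes hs)
  -- Decoding followed by the inverse isomorphism; composed with the factor map `f` onto `Z`, it is
  -- the required map.
  let F : Z → X := fun y => e.symm ⟨decodePoint hs n y.1, decodePoint_mem_solutions hs y.2⟩
  refine ⟨a, Y, hY, F ∘ f, Continuous.comp ?_ hf, Function.Surjective.comp ?_ hfs, fun γ y => ?_⟩
  · exact e.symm.continuous.comp
      (((continuous_decodePoint hs).comp continuous_subtype_val).subtype_mk _)
  · intro x
    obtain ⟨y, hy, hyx⟩ := exists_decodePoint_eq hs (e x).2
    refine ⟨⟨y, hy⟩, ?_⟩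
    rw [← e.symm_apply_apply x]
    exact congrArg e.symm (Subtype.ext hyx)
  · refine (congrArg F (hfe γ y)).trans (e.injective ?_)
    refine (e.apply_symm_apply _).trans (Subtype.ext ?_)
    funext i h
    rw [he]
    have h1 : e ((F ∘ f) y) = ⟨decodePoint hs n (f y).1, decodePoint_mem_solutions hs (f y).2⟩ :=
      e.apply_symm_apply _
    rw [h1]
    refine (decodePoint_comp_movePos hs (f y).2 _ i h).trans ?_
    rw [MonoidHom.id_apply, (hs.exists_num_eq γ⁻¹).choose_spec]
    rfl

end AlgSFT
end

theorem theoremC (Γ : Type*) [Group Γ] (hfg : Group.FG Γ)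
    (hrec : AlgSFT.IsRecursivelyPresentedGroup Γ) (hsim : AlgSFT.IsSelfSimulable Γ)
    (X : Type*) [AddCommGroup X] [TopologicalSpace X] [IsTopologicalAddGroup X]
    [CompactSpace X] [TopologicalSpace.MetrizableSpace X]
    [DistribMulAction Γ X] [ContinuousConstSMul Γ X] :
    (AlgSFT.IsFinitelyPresentedAction Γ X → AlgSFT.IsFactorOfSFT Γ X) ∧
      (AlgSFT.IsRecursivelyPresentedAction Γ X → AlgSFT.IsFactorOfSFT Γ X) := by
  obtain ⟨m, s, hs, -⟩ := id hrec
  exact ⟨fun h => (h.isRecursivelyPresentedAction hs).isFactorOfSFT hrec hsim,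
    fun h => h.isFactorOfSFT hrec hsim⟩
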